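/- Theorem 5.3. Consider a binary Glass network on $\mathbb{R}^n$, $$\dot y_i=-y_i+F_i(\tilde y_1,\dots,\tilde y_n),\qquad i=1,\dots,n,$$ with one threshold $\theta_i$ per variable, where $\tilde y_i\in\{0,1\}$ records whether $y_i<\theta_i$ or $y_i>\theta_i$. The $2^n$ open orthants cut out by the thresholds are the regions; the constant value $F$ of the right-hand side on a region is its focal point, and we assume that $F_i\neq\theta_i$ for every focal point $F$ and every $i$. A cyclic attractor $\mathcal C$ is a cycle of $k\ge 1$ pairwise distinct regions $\mathcal O_0\to\mathcal O_1\to\dots\to\mathcal O_{k-1}\to\mathcal O_0$ (indices modulo $k$) such that, for every $i$: $\mathcal O_i$ and $\mathcal O_{i+1}$ lie on different sides of exactly one threshold, that of the variable $m_i$; the $m_i$-th coordinates of the focal points of both $\mathcal O_i$ and $\mathcal O_{i+1}$ lie on the side of $\theta_{m_i}$ that contains $\mathcal O_{i+1}$; and every trajectory $F+(x-F)e^{-t}$ with $x\in\mathcal O_i$ ($F$ being the focal point of $\mathcal O_i$) leaves $\mathcal O_i$ through the relatively open wall $\mathcal W_i$ between $\mathcal O_i$ and $\mathcal O_{i+1}$.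 It is not assumed that every variable switches along the cycle. Trajectories in $\mathcal C$ live in $\bigcup_i(\mathcal O_i\cup\mathcal W_i)$, the dynamics on $\mathcal W_i$ being the continuous extension of that of $\mathcal O_{i+1}$; a maximal trajectory is defined on $[0,T)$ with $0<T\le\infty$. A periodic orbit of $\mathcal C$ is the orbit of a periodic trajectory in $\mathcal C$. The spine is $\mathcal S(\mathcal C)=\bigcap_{i}\overline{\mathcal W_i}$. Then exactly one of the following holds: 1. $\mathcal C$ has a unique periodic orbit, and this orbit is asymptotically stable; 2. along every maximal trajectory $y:[0,T)\to\mathbb{R}^n$ in $\mathcal C$, the distance from $y(t)$ to $\mathcal S(\mathcal C)$ tends to $0$ as $t\to T$ (with $T$ finite or infinite). The case and the periodic orbit can be calculated as follows. Let $f^i$ be the focal point of $\mathcal O_i$ minus $\theta$, let $e_m$ be the $m$-th standard basis vector, and put $$B_i=I-\frac{f^i e_{m_i}^{T}}{f^i_{m_i}},\quad \psi_i=-\frac{e_{m_i}}{f^i_{m_i}},\quad A=B_{k-1}\cdots B_1B_0,\quad \varphi=\sum_{j=0}^{k-1}(B_{j-1}\cdots B_0)^{T}\psi_j ,$$ so that,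 in coordinates centred at $\theta$, the Poincaré return map of $\mathcal W_{k-1}$ is $x\mapsto Ax/(1+\langle\varphi,x\rangle)$. Case 1 holds if and only if $A$ has a real eigenvalue greater than $1$. In that case the largest real eigenvalue $\lambda$ of $A$ has a one-dimensional eigenspace in $\mathbb R^n$, this eigenspace contains a vector $v$ with $\langle\varphi,v\rangle=\lambda-1$, and the periodic orbit meets $\mathcal W_{k-1}$ at the point $\theta+v$. -/

import Mathlib

/-- A binary Glass network `yᵢ' = - yᵢ + Fᵢ(ỹ₁, …, ỹₙ)` on `ℝⁿ`, one threshold `θᵢ` per variable.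
A region (orthant) is encoded by `σ : Fin n → Bool` (`true` is "above the threshold"), and
`focal σ` is the focal point `F(σ)` of that region. No coordinate of a focal point is a threshold.
`ℝⁿ` is `Fin n → ℝ`; only notions that do not depend on the choice of a norm are used. -/
structure BinaryGlassNetwork (n : ℕ) where
  θ : Fin n → ℝ
  focal : (Fin n → Bool) → Fin n → ℝ
  focal_ne : ∀ σ i, focal σ i ≠ θ i

namespace BinaryGlassNetwork

variable {n k : ℕ} [NeZero k]

/-- The real number `a` lies strictly on the side `b` of the `i`-th threshold. -/
def OnSide (N : BinaryGlassNetwork n) (i : Fin n) (b : Bool) (a : ℝ) : Prop :=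
  if b = true then N.θ i < a else a < N.θ i

/-- The open orthant with code `σ`. -/
def region (N : BinaryGlassNetwork n) (σ : Fin n → Bool) : Set (Fin n → ℝ) :=
  {x | ∀ i, N.OnSide i (σ i) (x i)}

/-- The (relatively open) wall of the orthant `σ` on which the `m`-th variable is at threshold. -/
def wall (N : BinaryGlassNetwork n) (σ : Fin n → Bool) (m : Fin n) : Set (Fin n → ℝ) :=
  {x | x m = N.θ m ∧ ∀ i, i ≠ m → N.OnSide i (σ i) (x i)}

/-- The solution `F + (x - F) e^{-t}` of `y' = F - y`, `y(0) = x`, for the focal point of `σ`. -/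
noncomputable def flow (N : BinaryGlassNetwork n) (σ : Fin n → Bool) (x : Fin n → ℝ) (t : ℝ) :
    Fin n → ℝ :=
  N.focal σ + Real.exp (-t) • (x - N.focal σ)

/-- `O 0 → O 1 → ⋯ → O (k-1) → O 0` (indices in `Fin k`, so `i + 1` is cyclic) is a cyclic
attractor, `s i` being the variable that switches from `O i` to `O (i + 1)`. -/
structure IsCyclicAttractor (N : BinaryGlassNetwork n) (O : Fin k → Fin n → Bool)
    (s : Fin k → Fin n) : Prop where
  /-- the regions of the cycle are pairwise distinct -/
  injective : Function.Injective O
  /-- consecutive regions are separated by a wall of the variable `s i` -/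
  adjacent : ∀ i, O (i + 1) = Function.update (O i) (s i) (!(O i (s i)))
  /-- the flow of `O i` points towards the wall between `O i` and `O (i + 1)` … -/
  towards : ∀ i, N.OnSide (s i) (O (i + 1) (s i)) (N.focal (O i) (s i))
  /-- … and the flow of `O (i + 1)` points away from it -/
  away : ∀ i, N.OnSide (s i) (O (i + 1) (s i)) (N.focal (O (i + 1)) (s i))
  /-- every trajectory starting in `O i` leaves `O i` through the wall to `O (i + 1)` -/
  enters : ∀ i, ∀ x ∈ N.region (O i), ∃ t : ℝ, 0 < t ∧
    (∀ r : ℝ, 0 ≤ r → r < t → N.flow (O i) x r ∈ N.region (O i)) ∧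
    N.flow (O i) x t ∈ N.wall (O i) (s i)

/-- The points at which the dynamics is that of `O i`: the region `O i` together with the wall
through which it is entered from `O (i - 1)`. -/
def piece (N : BinaryGlassNetwork n) (O : Fin k → Fin n → Bool) (s : Fin k → Fin n) (i : Fin k) :
    Set (Fin n → ℝ) :=
  N.region (O i) ∪ N.wall (O i) (s (i - 1))

/-- The spine of a cycle: the common part of the closures of its walls. -/
def spine (N : BinaryGlassNetwork n) (O : Fin k → Fin n → Bool) (s : Fin k → Fin n) :
    Set (Fin n → ℝ) :=
  ⋂ i, closure (N.wall (O i) (s i))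

/-- `y`, restricted to `[0, T)` with `0 < T ≤ ∞`, is a trajectory in the cycle: it is continuous,
stays in the regions of the cycle and the walls between them, and has right derivative
`F - y`, where `F` is the focal point of the current region, the dynamics on each wall being the
continuous extension of the dynamics of the region that is entered. -/
structure IsTrajectory (N : BinaryGlassNetwork n) (O : Fin k → Fin n → Bool) (s : Fin k → Fin n)
    (y : ℝ → Fin n → ℝ) (T : EReal) : Prop where
  pos : 0 < T
  continuousOn : ContinuousOn y {t : ℝ | 0 ≤ t ∧ (t : EReal) < T}
  mem : ∀ t : ℝ, 0 ≤ t → (t : EReal) < T → ∃ i, y t ∈ N.piece O s i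
  deriv : ∀ t : ℝ, 0 ≤ t → (t : EReal) < T → ∀ i, y t ∈ N.piece O s i →
    HasDerivWithinAt y (N.focal (O i) - y t) (Set.Ici t) t

/-- A trajectory on `[0, T)` that cannot be continued in the cycle beyond `T`. -/
def IsMaximalTrajectory (N : BinaryGlassNetwork n) (O : Fin k → Fin n → Bool) (s : Fin k → Fin n)
    (y : ℝ → Fin n → ℝ) (T : EReal) : Prop :=
  N.IsTrajectory O s y T ∧ ∀ (z : ℝ → Fin n → ℝ) (T' : EReal), N.IsTrajectory O s z T' →
    (∀ t : ℝ, 0 ≤ t → (t : EReal) < T → z t = y t) → T' ≤ T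

/-- `γ` is the orbit of a periodic trajectory in the cycle, defined for all times. -/
def IsPeriodicOrbit (N : BinaryGlassNetwork n) (O : Fin k → Fin n → Bool) (s : Fin k → Fin n)
    (γ : Set (Fin n → ℝ)) : Prop :=
  ∃ (y : ℝ → Fin n → ℝ) (P : ℝ), N.IsTrajectory O s y ⊤ ∧ 0 < P ∧
    (∀ t : ℝ, 0 ≤ t → y (t + P) = y t) ∧ γ = y '' Set.Ici 0

/-- `γ` is (orbitally) asymptotically stable: trajectories that start near `γ` exist for all times
and stay near `γ`, and those that start near enough converge to `γ`. -/
def IsAsymptoticallyStable (N : BinaryGlassNetwork n) (O : Fin k → Fin n → Bool)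
    (s : Fin k → Fin n) (γ : Set (Fin n → ℝ)) : Prop :=
  (∀ ε : ℝ, 0 < ε → ∃ δ : ℝ, 0 < δ ∧ ∀ (y : ℝ → Fin n → ℝ) (T : EReal),
    N.IsMaximalTrajectory O s y T → Metric.infDist (y 0) γ < δ →
      T = ⊤ ∧ ∀ t : ℝ, 0 ≤ t → Metric.infDist (y t) γ < ε) ∧
  ∃ δ : ℝ, 0 < δ ∧ ∀ (y : ℝ → Fin n → ℝ) (T : EReal),
    N.IsMaximalTrajectory O s y T → Metric.infDist (y 0) γ < δ →
      T = ⊤ ∧ Filter.Tendsto (fun t => Metric.infDist (y t) γ) Filter.atTop (nhds 0)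

/-- There is exactly one periodic orbit in the cycle, and it is asymptotically stable. -/
def HasUniqueStablePeriodicOrbit (N : BinaryGlassNetwork n) (O : Fin k → Fin n → Bool)
    (s : Fin k → Fin n) : Prop :=
  ∃ γ, N.IsPeriodicOrbit O s γ ∧ (∀ γ', N.IsPeriodicOrbit O s γ' → γ' = γ) ∧
    N.IsAsymptoticallyStable O s γ

/-- Along every maximal trajectory in the cycle, on `[0, T)` say, the distance to the spine tends
to `0` as `t → T` from below, with `T` finite (finite time convergence) or infinite. -/
def AllConvergeToSpine (N : BinaryGlassNetwork n) (O : Fin k → Fin n → Bool)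
    (s : Fin k → Fin n) : Prop :=
  ∀ (y : ℝ → Fin n → ℝ) (T : EReal), N.IsMaximalTrajectory O s y T →
    ∀ ε : ℝ, 0 < ε → ∃ r : ℝ, 0 ≤ r ∧ (r : EReal) < T ∧
      ∀ t : ℝ, r ≤ t → (t : EReal) < T → Metric.infDist (y t) (N.spine O s) < ε

/-- In coordinates centred at `θ`, with `f = focal (O i) - θ` and `m = s i`, the map from the
entrance wall to the exit wall of `O i` is `x ↦ B x / (1 + ⟨ψ, x⟩)`; this is
`B = 1 - f eₘᵀ / fₘ`. -/
noncomputable def stepMatrix (N : BinaryGlassNetwork n) (O : Fin k → Fin n → Bool)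
    (s : Fin k → Fin n) (i : Fin k) : Matrix (Fin n) (Fin n) ℝ :=
  1 - Matrix.vecMulVec (N.focal (O i) - N.θ)
    (Pi.single (s i) (N.focal (O i) (s i) - N.θ (s i))⁻¹)

/-- The vector `ψ = - eₘ / fₘ` of the same map. -/
noncomputable def stepCovector (N : BinaryGlassNetwork n) (O : Fin k → Fin n → Bool)
    (s : Fin k → Fin n) (i : Fin k) : Fin n → ℝ :=
  Pi.single (s i) (-(N.focal (O i) (s i) - N.θ (s i))⁻¹)

/-- The product `B_{j-1} ⋯ B_1 B_0` of the step matrices. -/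
noncomputable def prodMatrix (N : BinaryGlassNetwork n) (O : Fin k → Fin n → Bool)
    (s : Fin k → Fin n) : ℕ → Matrix (Fin n) (Fin n) ℝ
  | 0 => 1
  | j + 1 => N.stepMatrix O s (Fin.ofNat k j) * N.prodMatrix O s j

/-- The matrix `A = B_{k-1} ⋯ B_0` of the Poincaré return map `x ↦ A x / (1 + ⟨φ, x⟩)` of the wall
between `O (k-1)` and `O 0`, in coordinates centred at `θ`. -/
noncomputable def returnMatrix (N : BinaryGlassNetwork n) (O : Fin k → Fin n → Bool)
    (s : Fin k → Fin n) : Matrix (Fin n) (Fin n) ℝ :=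
  N.prodMatrix O s k

/-- The vector `φ = ∑ⱼ (B_{j-1} ⋯ B_0)ᵀ ψ_j` of the Poincaré return map. -/
noncomputable def returnCovector (N : BinaryGlassNetwork n) (O : Fin k → Fin n → Bool)
    (s : Fin k → Fin n) : Fin n → ℝ :=
  ∑ j ∈ Finset.range k, Matrix.vecMul (N.stepCovector O s (Fin.ofNat k j)) (N.prodMatrix O s j)

end BinaryGlassNetwork

/-! Multiply the deviation from the thresholds by `e^t`. Inside `O i` the curve `e^t (y - θ)` is
affine in `e^t` with velocity `F - θ`. Since every trajectory leaves `O i` through one relatively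
open wall, the focal point of `O i` must lie in `O (i + 1)` (`focal_side`). In absolute values, the
switching coordinate therefore falls to `0` while all others rise, and so does the extra coordinate
`none`, which records `e^t`. Crossing a region becomes a nonnegative linear map on `Option (Fin n) →
ℝ`; the actual point is read off from quotients by the coordinate `none`, the time from its
logarithm. The return map is the projectivisation of one nonnegative linear map,
`CyclicSystem.loop`.

Coordinates that never switch, `none` among them, influence no other coordinate, so `loop` is block
triangular with an identity block there. On the switching coordinates, except the last one (which is
`0` after a turn), it is strictly positive and has a Perron eigenvalue `l`.

If `l > 1`, the Perron vector extends to an eigenvector `v` of the whole loop, positive on the wall.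
The loop contracts order intervals `[a v, b v]` relative to `l`, so every state converges
projectively to `v`, while `none` grows like `l ^ q` and time is unbounded. This gives a periodic
orbit that attracts everything, hence is unique; monotonicity of the steps gives stability. If `l ≤
1`, after `q` turns the switching coordinates have size `l ^ q` and `none` at least `1 + c q l ^ q`,
up to constants, so the quotients tend to `0`: convergence to the spine.

Trajectories run along straight segments between switchings, so controlling the switching points is
enough. Up to signs, the loop is the block matrix with `A` on the old coordinates and the row `(φ,
1)` for `none`. Hence its eigenvalues above `1` are those of `A`, and normalising `none` to `1`
gives `⟨φ, v⟩ = λ - 1`. -/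

/-! ### Perron eigenvectors of strictly positive matrices -/

/-- A strictly positive square matrix has a positive eigenvector. -/
theorem Matrix.exists_pos_eigenvector {κ : Type*} [Fintype κ] [Nonempty κ] (P : Matrix κ κ ℝ)
    (hP : ∀ a b, 0 < P a b) :
    ∃ (l : ℝ) (u : κ → ℝ), 0 < l ∧ (∀ a, 0 < u a) ∧ P.mulVec u = l • u := by
  classical
  set M : ℝ := ∑ a, ∑ b, P a b with hM
  have hM0 : 0 ≤ M := Finset.sum_nonneg fun a _ => Finset.sum_nonneg fun b _ => (hP a b).le
  -- Collatz–Wielandt: the eigenvalue is the largest `l` with `l w ≤ P w` for some `w` in the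
  -- simplex. The sum `M` of all entries bounds such `l`, which makes the search compact.
  let K : Set ((κ → ℝ) × ℝ) :=
    (stdSimplex ℝ κ ×ˢ Set.Icc 0 M) ∩ {w | w.2 • w.1 ≤ P.mulVec w.1}
  have hcont : Continuous fun w : (κ → ℝ) × ℝ => P.mulVec w.1 :=
    Continuous.matrix_mulVec continuous_const continuous_fst
  have hK : IsCompact K :=
    ((isCompact_stdSimplex ℝ κ).prod isCompact_Icc).inter_right
      (isClosed_le (continuous_snd.smul continuous_fst) hcont)
  have hpos : ∀ w : κ → ℝ, 0 ≤ w → w ≠ 0 → ∀ a, 0 < P.mulVec w a := by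
    intro w hw hne a
    obtain ⟨b, hb⟩ := Function.ne_iff.1 hne
    exact Finset.sum_pos' (fun c _ => mul_nonneg (hP a c).le (hw c))
      ⟨b, Finset.mem_univ _, mul_pos (hP a b) (lt_of_le_of_ne (hw b) (Ne.symm hb))⟩
  have hKn : K.Nonempty := by
    obtain ⟨a⟩ := ‹Nonempty κ›
    refine ⟨(Pi.single a 1, 0), ⟨single_mem_stdSimplex ℝ a, le_rfl, hM0⟩, ?_⟩
    intro b
    simpa using (hP b a).le
  obtain ⟨⟨u, l⟩, ⟨⟨hu, hl⟩, hul⟩, hmax⟩ := hK.exists_isMaxOn hKn continuous_snd.continuousOn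
  simp only [Set.mem_ofPred_eq] at hul hu hl
  have hu0 : 0 ≤ u := hu.1
  have hune : u ≠ 0 := by
    rintro rfl
    simpa using hu.2
  have hPu := hpos u hu0 hune
  -- A nonzero gap `P u - l u ≥ 0` becomes positive in every coordinate after applying `P`, so `P
  -- u`, rescaled into the simplex, would allow a larger `l`.
  have heq : P.mulVec u = l • u := by
    by_contra hne
    have h1 := hpos (P.mulVec u - l • u) (sub_nonneg.2 hul) (sub_ne_zero.2 hne)
    rw [Matrix.mulVec_sub, Matrix.mulVec_smul] at h1
    set u' := P.mulVec u with hu'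
    obtain ⟨a0, -, ha0⟩ := Finset.exists_min_image Finset.univ
      (fun a => (P.mulVec u' - l • u') a / u' a) Finset.univ_nonempty
    set e := (P.mulVec u' - l • u') a0 / u' a0 with he
    have he0 : 0 < e := div_pos (h1 a0) (hPu a0)
    have h2 : (l + e) • u' ≤ P.mulVec u' := by
      intro a
      have h3 := (le_div_iff₀ (hPu a)).1 (ha0 a (Finset.mem_univ _))
      simp only [Pi.sub_apply, Pi.smul_apply, smul_eq_mul] at h3 ⊢
      linarith
    set S := ∑ a, u' a with hS
    have hS0 : 0 < S := Finset.sum_pos (fun a _ => hPu a) Finset.univ_nonempty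
    have hle : l + e ≤ M := by
      have h4 : (l + e) * S ≤ M * S := by
        calc (l + e) * S = ∑ a, ((l + e) • u') a := by
              simp [hS, Finset.mul_sum]
          _ ≤ ∑ a, P.mulVec u' a := Finset.sum_le_sum fun a _ => h2 a
          _ ≤ ∑ a, ∑ b, P a b * S := by
              refine Finset.sum_le_sum fun a _ => Finset.sum_le_sum fun b _ => ?_
              exact mul_le_mul_of_nonneg_left
                (Finset.single_le_sum (fun c _ => (hPu c).le) (Finset.mem_univ b)) (hP a b).le
          _ = M * S := by simp [hM, Finset.sum_mul]
      exact le_of_mul_le_mul_right h4 hS0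
    have hmem : (S⁻¹ • u', l + e) ∈ K := by
      refine ⟨⟨⟨fun a => ?_, ?_⟩, add_nonneg hl.1 he0.le, hle⟩, ?_⟩
      · exact mul_nonneg (inv_nonneg.2 hS0.le) (hPu a).le
      · simp only [Pi.smul_apply, smul_eq_mul, ← Finset.mul_sum]
        exact inv_mul_cancel₀ hS0.ne'
      · simp only [Set.mem_ofPred_eq, Matrix.mulVec_smul]
        rw [smul_comm]
        exact smul_le_smul_of_nonneg_left h2 (inv_nonneg.2 hS0.le)
    have := hmax hmem
    simp only [Set.mem_ofPred_eq] at this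
    linarith
  have hlu : ∀ a, 0 < l * u a := fun a => by
    have := hPu a
    rwa [heq] at this
  have hl0 : 0 < l := by
    obtain ⟨a⟩ := ‹Nonempty κ›
    exact (pos_iff_pos_of_mul_pos (hlu a)).2 (lt_of_le_of_ne (hu0 a) fun h => by
      have := hlu a
      rw [← h] at this
      simp at this)
  exact ⟨l, u, hl0, fun a => pos_of_mul_pos_right (hlu a) hl0.le, heq⟩

/-! ### Cyclic systems of nonnegative linear steps -/

/-- A cycle of projective steps in absolute coordinates: in the `r`-th step the `m r`-th coordinate
decreases to `0` while all other coordinates increase, the speeds being `g r`. -/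
structure CyclicSystem (ι : Type*) where
  k : ℕ
  g : ℕ → ι → ℝ
  m : ℕ → ι
  k_pos : 0 < k
  g_pos : ∀ r j, 0 < g r j
  m_succ_ne : ∀ r, m (r + 1) ≠ m r
  g_add : ∀ r, g (r + k) = g r
  m_add : ∀ r, m (r + k) = m r

namespace CyclicSystem

variable {ι : Type*} (C : CyclicSystem ι)

theorem m_mul_add (q r : ℕ) : C.m (q * C.k + r) = C.m r := by
  induction q with
  | zero => simp
  | succ q ih => rw [show (q + 1) * C.k + r = (q * C.k + r) + C.k by ring, C.m_add, ih]

/-- The switching coordinates. -/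
def switching : Set ι := Set.range C.m

theorem exists_lt_of_switching {l : ι} (hl : l ∈ C.switching) : ∃ i < C.k, C.m i = l := by
  obtain ⟨i, rfl⟩ := hl
  refine ⟨i % C.k, Nat.mod_lt _ C.k_pos, ?_⟩
  conv_rhs => rw [← Nat.div_add_mod' i C.k]
  rw [m_mul_add]

/-- The coordinate that vanishes after a complete turn. -/
def last : ι := C.m (C.k - 1)

theorem last_switching : C.last ∈ C.switching := ⟨_, rfl⟩

theorem exists_switching_ne_last : ∃ l ∈ C.switching, l ≠ C.last := by
  refine ⟨C.m 0, ⟨0, rfl⟩, ?_⟩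
  have := C.m_succ_ne (C.k - 1)
  rwa [Nat.sub_add_cancel C.k_pos, ← Nat.zero_add C.k, C.m_add, Nat.zero_add] at this

variable [DecidableEq ι]

/-- The linear map from the entrance to the exit of the `r`-th step. -/
noncomputable def step (r : ℕ) : (ι → ℝ) →ₗ[ℝ] (ι → ℝ) where
  toFun X j := if j = C.m r then 0 else X j + C.g r j / C.g r (C.m r) * X (C.m r)
  map_add' X Y := by
    ext j
    by_cases h : j = C.m r
    · simp [h]
    · simp [h]; ring
  map_smul' c X := by
    ext j
    by_cases h : j = C.m r
    · simp [h]
    · simp [h]; ring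

/-- The first `r` steps starting with step `p`. -/
noncomputable def cyc (p : ℕ) : ℕ → (ι → ℝ) →ₗ[ℝ] (ι → ℝ)
  | 0 => LinearMap.id
  | r + 1 => C.step (p + r) ∘ₗ cyc p r

/-- One turn around the cycle. -/
noncomputable def loop : (ι → ℝ) →ₗ[ℝ] (ι → ℝ) := C.cyc 0 C.k

/-- The state `X` is on the wall where the `r`-th step ends. -/
def OnWall (r : ℕ) (X : ι → ℝ) : Prop := X (C.m r) = 0 ∧ ∀ j, j ≠ C.m r → 0 < X j

theorem step_apply (r : ℕ) (X : ι → ℝ) (j : ι) :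
    C.step r X j = if j = C.m r then 0 else X j + C.g r j / C.g r (C.m r) * X (C.m r) := rfl

theorem step_apply_self (r : ℕ) (X : ι → ℝ) : C.step r X (C.m r) = 0 := by simp [step_apply]

theorem step_apply_of_ne (r : ℕ) (X : ι → ℝ) {j : ι} (h : j ≠ C.m r) :
    C.step r X j = X j + C.g r j / C.g r (C.m r) * X (C.m r) := by simp [step_apply, h]

@[simp] theorem cyc_zero (p : ℕ) (X : ι → ℝ) : C.cyc p 0 X = X := rfl

theorem cyc_succ (p r : ℕ) (X : ι → ℝ) : C.cyc p (r + 1) X = C.step (p + r) (C.cyc p r X) := rfl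

theorem cyc_add (p a b : ℕ) (X : ι → ℝ) : C.cyc p (a + b) X = C.cyc (p + a) b (C.cyc p a X) := by
  induction b with
  | zero => rfl
  | succ b ih => rw [← add_assoc, cyc_succ, cyc_succ, ih, add_assoc]

theorem step_add_period (r : ℕ) : C.step (r + C.k) = C.step r := by
  ext X j
  simp [step_apply, C.g_add, C.m_add]

theorem cyc_add_period (p r : ℕ) (X : ι → ℝ) : C.cyc (p + C.k) r X = C.cyc p r X := by
  induction r with
  | zero => rfl
  | succ r ih => rw [cyc_succ, cyc_succ, ih, add_right_comm, step_add_period]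

theorem cyc_period_add (r : ℕ) (X : ι → ℝ) : C.cyc 0 (C.k + r) X = C.cyc 0 r (C.loop X) := by
  rw [cyc_add, cyc_add_period]
  rfl

theorem cyc_mul_add (q r : ℕ) (X : ι → ℝ) :
    C.cyc 0 (q * C.k + r) X = C.cyc 0 r ((C.loop ^ q) X) := by
  induction q generalizing X with
  | zero => simp
  | succ q ih =>
    rw [show (q + 1) * C.k + r = C.k + (q * C.k + r) by ring, cyc_period_add, ih, pow_succ]
    rfl

theorem step_nonneg (r : ℕ) {X : ι → ℝ} (hX : 0 ≤ X) : 0 ≤ C.step r X := by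
  intro j
  rw [step_apply]
  split_ifs
  · exact le_rfl
  · exact add_nonneg (hX j) (mul_nonneg (div_pos (C.g_pos _ _) (C.g_pos _ _)).le (hX _))

theorem cyc_nonneg (p r : ℕ) {X : ι → ℝ} (hX : 0 ≤ X) : 0 ≤ C.cyc p r X := by
  induction r with
  | zero => exact hX
  | succ r ih => exact C.step_nonneg _ ih

theorem cyc_mono (p r : ℕ) {X Y : ι → ℝ} (h : X ≤ Y) : C.cyc p r X ≤ C.cyc p r Y := by
  have := C.cyc_nonneg p r (sub_nonneg.2 h)
  rwa [map_sub, sub_nonneg] at this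

theorem loop_mono {X Y : ι → ℝ} (h : X ≤ Y) : C.loop X ≤ C.loop Y := C.cyc_mono 0 _ h

theorem onWall_step (r : ℕ) {X : ι → ℝ} (hX : 0 ≤ X) (h : 0 < X (C.m r)) :
    C.OnWall r (C.step r X) := by
  refine ⟨C.step_apply_self r X, fun j hj => ?_⟩
  rw [C.step_apply_of_ne r X hj]
  exact add_pos_of_nonneg_of_pos (hX j) (mul_pos (div_pos (C.g_pos _ _) (C.g_pos _ _)) h)

variable {C} in
theorem OnWall.nonneg {r : ℕ} {X : ι → ℝ} (h : C.OnWall r X) : 0 ≤ X := fun j => by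
  by_cases hj : j = C.m r
  · rw [hj, h.1]; exact le_rfl
  · exact (h.2 j hj).le

variable {C} in
theorem OnWall.step {r : ℕ} {X : ι → ℝ} (h : C.OnWall r X) :
    C.OnWall (r + 1) (C.step (r + 1) X) :=
  C.onWall_step _ h.nonneg (h.2 _ (C.m_succ_ne r))

variable {C} in
theorem OnWall.cyc {p : ℕ} {X : ι → ℝ} (h : C.OnWall p X) (r : ℕ) :
    C.OnWall (p + r) (C.cyc (p + 1) r X) := by
  induction r with
  | zero => exact h
  | succ r ih =>
    rw [cyc_succ, add_right_comm]
    exact ih.step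

theorem onWall_cyc {p : ℕ} {X : ι → ℝ} (hX : 0 ≤ X) (h : 0 < X (C.m p)) (r : ℕ) :
    C.OnWall (p + r) (C.cyc p (r + 1) X) := by
  rw [add_comm r 1, cyc_add]
  exact (C.onWall_step p hX h).cyc r

/-- A positive coordinate does not decrease before its first switching, and that step then makes all
other coordinates positive. The first switching comes no later than step `i`. -/
theorem onWall_cyc_of_pos {X : ι → ℝ} (hX : 0 ≤ X) {i : ℕ} (h : 0 < X (C.m i)) {r : ℕ}
    (hr : i ≤ r) : C.OnWall r (C.cyc 0 (r + 1) X) := by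
  classical
  have hex : ∃ i', C.m i' = C.m i := ⟨i, rfl⟩
  obtain ⟨i', hi', hmin⟩ : ∃ i', C.m i' = C.m i ∧ ∀ t < i', C.m t ≠ C.m i :=
    ⟨Nat.find hex, Nat.find_spec hex, fun t ht => Nat.find_min hex ht⟩
  have hi'i : i' ≤ i := by
    by_contra! hlt
    exact hmin i hlt rfl
  have hpos : ∀ t, t ≤ i' → 0 < C.cyc 0 t X (C.m i) := by
    intro t
    induction t with
    | zero => exact fun _ => h
    | succ t ih =>
      intro ht
      have h0 := C.cyc_nonneg 0 t hX
      rw [cyc_succ, zero_add, C.step_apply_of_ne t _ (hmin t ht).symm]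
      exact add_pos_of_pos_of_nonneg (ih (by omega))
        (mul_nonneg (div_pos (C.g_pos _ _) (C.g_pos _ _)).le (h0 _))
  have h1 := C.onWall_cyc (p := i') (C.cyc_nonneg 0 i' hX) (by rw [hi']; exact hpos i' le_rfl)
    (r - i')
  have h2 : C.cyc 0 (r + 1) X = C.cyc i' (r - i' + 1) (C.cyc 0 i' X) := by
    have := C.cyc_add 0 i' (r - i' + 1) X
    rw [zero_add] at this
    rw [← this]
    congr 2
    omega
  rw [h2]
  rwa [show i' + (r - i') = r by omega] at h1

theorem loop_last (X : ι → ℝ) : C.loop X C.last = 0 := by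
  have h : C.loop X = C.cyc 0 (C.k - 1 + 1) X := by
    rw [Nat.sub_add_cancel C.k_pos]; rfl
  rw [h, cyc_succ, zero_add]
  exact C.step_apply_self _ _

theorem onWall_loop {X : ι → ℝ} (hX : 0 ≤ X) {l : ι} (hl : l ∈ C.switching) (h : 0 < X l) :
    C.OnWall (C.k - 1) (C.loop X) := by
  obtain ⟨i, hi, rfl⟩ := C.exists_lt_of_switching hl
  have := C.onWall_cyc_of_pos hX h (r := C.k - 1) (by omega)
  rwa [Nat.sub_add_cancel C.k_pos] at this

theorem loop_pos {X : ι → ℝ} (hX : 0 ≤ X) {l : ι} (hl : l ∈ C.switching) (h : 0 < X l) {j : ι}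
    (hj : j ≠ C.last) : 0 < C.loop X j := (C.onWall_loop hX hl h).2 j hj

/-- A step only transfers mass out of its switching coordinate, so there is nothing to transfer.
This is the identity block of the block triangular loop. -/
theorem cyc_of_switching_eq_zero {X : ι → ℝ} (hX : ∀ j ∈ C.switching, X j = 0) (p r : ℕ) :
    C.cyc p r X = X := by
  induction r with
  | zero => rfl
  | succ r ih =>
    rw [cyc_succ, ih]
    ext j
    rw [step_apply]
    split_ifs with h
    · rw [h, hX _ ⟨_, rfl⟩]
    · rw [hX (C.m _) ⟨_, rfl⟩]; simp

theorem loop_of_switching_eq_zero {X : ι → ℝ} (hX : ∀ j ∈ C.switching, X j = 0) :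
    C.loop X = X := C.cyc_of_switching_eq_zero hX _ _

theorem cyc_congr_switching {X Y : ι → ℝ} (h : ∀ j ∈ C.switching, X j = Y j) (p r : ℕ) {j : ι}
    (hj : j ∈ C.switching) : C.cyc p r X j = C.cyc p r Y j := by
  have h1 : C.cyc p r (X - Y) = X - Y :=
    C.cyc_of_switching_eq_zero (fun j hj => by simp [h j hj]) _ _
  rw [map_sub] at h1
  have := congrFun h1 j
  simp only [Pi.sub_apply, h j hj, sub_self] at this
  linarith

/-- The coordinates that never switch do not act on the switching ones, so they need not be
compared: `W` replaces the difference there by `0`. -/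
theorem cyc_le_switching {X Y : ι → ℝ} (h : ∀ j ∈ C.switching, X j ≤ Y j) (p r : ℕ) {j : ι}
    (hj : j ∈ C.switching) : C.cyc p r X j ≤ C.cyc p r Y j := by
  classical
  let W : ι → ℝ := fun i => if i ∈ C.switching then Y i - X i else 0
  have hW : 0 ≤ W := fun i => by
    by_cases hi : i ∈ C.switching
    · simp [W, hi, h i hi]
    · simp [W, hi]
  have h1 := C.cyc_congr_switching (X := W) (Y := Y - X) (fun i hi => by simp [W, hi]) p r hj
  have h2 := C.cyc_nonneg p r hW j
  rw [h1, map_sub] at h2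
  simpa using h2

/-! ### Perron data and positive eigenvectors of one turn -/

/-- Data of a Perron eigenvector of the loop on the switching coordinates. -/
structure IsPerron (l : ℝ) (u : ι → ℝ) : Prop where
  pos : 0 < l
  last : u C.last = 0
  switching_pos : ∀ j ∈ C.switching, j ≠ C.last → 0 < u j
  not_switching : ∀ j, j ∉ C.switching → u j = 0
  loop_eq : ∀ j ∈ C.switching, C.loop u j = l * u j

/-- On the switching coordinates other than `last`, whose row vanishes, the matrix of the loop is
strictly positive. Outside the switching coordinates the loop of `u` need not vanish, so the
eigenvalue equation is only claimed on them. -/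
theorem exists_isPerron [Fintype ι] : ∃ l u, C.IsPerron l u := by
  classical
  let κ := {j : ι // j ∈ C.switching ∧ j ≠ C.last}
  obtain ⟨l0, hl0, hl0'⟩ := C.exists_switching_ne_last
  have : Nonempty κ := ⟨⟨l0, hl0, hl0'⟩⟩
  let P : Matrix κ κ ℝ := fun a b => C.loop (Pi.single b.1 1) a.1
  have hP : ∀ a b, 0 < P a b := fun a b =>
    C.loop_pos (Pi.single_nonneg.2 zero_le_one) b.2.1 (by simp) a.2.2
  obtain ⟨l, u, hl, hu, hPu⟩ := P.exists_pos_eigenvector hP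
  let U : ι → ℝ := ∑ b : κ, u b • (Pi.single b.1 1 : ι → ℝ)
  have hU : ∀ j, U j = if h : j ∈ C.switching ∧ j ≠ C.last then u ⟨j, h⟩ else 0 := by
    intro j
    simp only [U, Finset.sum_apply, Pi.smul_apply, smul_eq_mul, Pi.single_apply]
    split_ifs with h
    · rw [Finset.sum_eq_single ⟨j, h⟩]
      · simp
      · intro b _ hb
        have : j ≠ b.1 := fun e => hb (Subtype.ext e.symm)
        simp [this]
      · simp
    · refine Finset.sum_eq_zero fun b _ => ?_
      have : j ≠ b.1 := fun e => h (e ▸ b.2)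
      simp [this]
  refine ⟨l, U, hl, by simp [hU], fun j hj hj' => ?_, fun j hj => ?_, fun j hj => ?_⟩
  · rw [hU, dif_pos ⟨hj, hj'⟩]; exact hu _
  · rw [hU, dif_neg (fun h => hj h.1)]
  · by_cases hj' : j = C.last
    · rw [hj', C.loop_last, hU]; simp
    · rw [hU, dif_pos ⟨hj, hj'⟩]
      have := congrFun hPu ⟨j, hj, hj'⟩
      simp only [Matrix.mulVec, dotProduct, P, Pi.smul_apply, smul_eq_mul] at this
      rw [← this]
      simp [U, map_sum, mul_comm]

variable {C}

theorem IsPerron.nonneg {l : ℝ} {u : ι → ℝ} (h : C.IsPerron l u) : 0 ≤ u := fun j => by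
  by_cases hj : j ∈ C.switching
  · by_cases hj' : j = C.last
    · rw [hj', h.last]; exact le_rfl
    · exact (h.switching_pos j hj hj').le
  · rw [h.not_switching j hj]; exact le_rfl

/-- Take the least `c` with `|X| ≤ c u` on the switching coordinates, attained at `j0`. Applying the
monotone loop to `±X` and reading off coordinate `j0` gives `μ c u ≤ l c u`. If `c = 0`, then `X` is
fixed by the loop, which `μ > 1` excludes. -/
theorem IsPerron.eigenvalue_le [Fintype ι] {l : ℝ} {u : ι → ℝ} (h : C.IsPerron l u) {μ : ℝ}
    (hμ : 1 < μ) {X : ι → ℝ} (hX : X ≠ 0) (hLX : C.loop X = μ • X) : μ ≤ l := by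
  classical
  have hlast : X C.last = 0 := by
    have := congrFun hLX C.last
    rw [C.loop_last] at this
    have : μ * X C.last = 0 := this.symm
    rcases mul_eq_zero.1 this with h | h
    · linarith
    · exact h
  obtain ⟨l0, hl0, hl0'⟩ := C.exists_switching_ne_last
  let T : Finset ι := Finset.univ.filter fun j => j ∈ C.switching ∧ j ≠ C.last
  obtain ⟨j0, hj0, hmax⟩ := Finset.exists_max_image T (fun j => |X j| / u j) ⟨l0, by simp [T, *]⟩
  simp only [T, Finset.mem_filter, Finset.mem_univ, true_and] at hj0 hmax
  have hu0 := h.switching_pos j0 hj0.1 hj0.2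
  set c := |X j0| / u j0 with hc
  have hbound : ∀ j ∈ C.switching, |X j| ≤ c * u j := by
    intro j hj
    by_cases hj' : j = C.last
    · rw [hj', hlast, h.last]; simp
    · exact (div_le_iff₀ (h.switching_pos j hj hj')).1 (hmax j ⟨hj, hj'⟩)
  have hc0 : 0 < c := by
    refine lt_of_le_of_ne (by positivity) fun hc0 => hX ?_
    have hS : ∀ j ∈ C.switching, X j = 0 := fun j hj => by
      have := hbound j hj
      rw [← hc0, zero_mul] at this
      exact abs_eq_zero.1 (le_antisymm this (abs_nonneg _))
    have h2 := C.loop_of_switching_eq_zero hS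
    rw [hLX] at h2
    ext j
    have h3 : μ * X j = X j := congrFun h2 j
    have h4 : (μ - 1) * X j = 0 := by linarith
    rcases mul_eq_zero.1 h4 with h | h
    · linarith
    · exact h
  have h1 := C.cyc_le_switching (X := X) (Y := c • u)
    (fun j hj => (le_abs_self _).trans (hbound j hj)) 0 C.k hj0.1
  have h2 := C.cyc_le_switching (X := -X) (Y := c • u)
    (fun j hj => (neg_le_abs _).trans (hbound j hj)) 0 C.k hj0.1
  change C.loop _ _ ≤ C.loop _ _ at h1 h2
  rw [map_smul] at h1 h2
  rw [map_neg] at h2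
  simp only [hLX, Pi.smul_apply, Pi.neg_apply, smul_eq_mul, h.loop_eq j0 hj0.1] at h1 h2
  have h3 : |X j0| = c * u j0 := by rw [hc]; field_simp
  have h4 : μ * (c * u j0) ≤ l * (c * u j0) := by
    rw [← h3]
    rcases abs_cases (X j0) with ⟨h5, -⟩ | ⟨h5, -⟩
    · rw [h5] at h3 ⊢; rw [h3] at h1 ⊢; linarith
    · rw [h5] at h3 ⊢
      have : X j0 = -(c * u j0) := by linarith
      rw [this] at h2 ⊢; linarith
  exact le_of_mul_le_mul_right h4 (mul_pos hc0 hu0)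

/-- A positive eigenvector of the loop for an eigenvalue greater than `1`. -/
structure IsPositiveEigenvector (C : CyclicSystem ι) (l : ℝ) (v : ι → ℝ) : Prop where
  one_lt : 1 < l
  onWall : C.OnWall (C.k - 1) v
  loop_eq : C.loop v = l • v

/-- Outside the switching coordinates the eigenvector equation reads `w + loop u = l w`; its
solution `loop u / (l - 1)` is positive exactly because `l > 1`. -/
theorem IsPerron.exists_positiveEigenvector {l : ℝ} {u : ι → ℝ} (h : C.IsPerron l u)
    (hl : 1 < l) {z : ι} (hz : z ∉ C.switching) :
    ∃ v, C.IsPositiveEigenvector l v ∧ v z = 1 := by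
  classical
  obtain ⟨l0, hl0, hl0'⟩ := C.exists_switching_ne_last
  have hLu := C.onWall_loop h.nonneg hl0 (h.switching_pos l0 hl0 hl0')
  let w : ι → ℝ := fun j => if j ∈ C.switching then 0 else C.loop u j / (l - 1)
  have hl1 : 0 < l - 1 := by linarith
  have hw : C.loop w = w := C.loop_of_switching_eq_zero fun j hj => by simp [w, hj]
  have hev : C.loop (u + w) = l • (u + w) := by
    rw [map_add, hw]
    ext j
    by_cases hj : j ∈ C.switching
    · simp [w, hj, h.loop_eq j hj]
    · simp only [Pi.add_apply, Pi.smul_apply, smul_eq_mul, w, hj, h.not_switching j hj, if_false]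
      field_simp
      ring
  have hpos : ∀ j, j ≠ C.last → 0 < (u + w) j := by
    intro j hj'
    by_cases hj : j ∈ C.switching
    · simpa [w, hj] using h.switching_pos j hj hj'
    · simp only [Pi.add_apply, w, hj, h.not_switching j hj, if_false, zero_add]
      exact div_pos (hLu.2 j hj') hl1
  have hzl : z ≠ C.last := fun e => hz (e ▸ C.last_switching)
  have hc := inv_pos.2 (hpos z hzl)
  refine ⟨((u + w) z)⁻¹ • (u + w), ⟨hl, ⟨?_, fun j hj => mul_pos hc (hpos j hj)⟩, ?_⟩, ?_⟩
  · change _ * (u C.last + w C.last) = 0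
    simp [h.last, w, C.last_switching]
  · rw [map_smul, hev, smul_comm]
  · exact inv_mul_cancel₀ (hpos z hzl).ne'

/-- With `t` the largest quotient `X j / v j`, the eigenvector `t v - X` is nonnegative and vanishes
at `j0`. A positive switching coordinate would make its loop positive at `j0`; so all of them
vanish, the loop fixes `t v - X`, and `l ≠ 1` forces it to be `0`. -/
theorem IsPositiveEigenvector.eq_smul [Fintype ι] {l : ℝ} {v : ι → ℝ}
    (h : C.IsPositiveEigenvector l v) {X : ι → ℝ} (hX : C.loop X = l • X) : ∃ c : ℝ, X = c • v := by
  classical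
  obtain ⟨l0, hl0, hl0'⟩ := C.exists_switching_ne_last
  obtain ⟨j0, hj0, hmax⟩ := Finset.exists_max_image (Finset.univ.filter fun j => j ≠ C.last)
    (fun j => X j / v j) ⟨l0, by simp [hl0']⟩
  simp only [Finset.mem_filter, Finset.mem_univ, true_and] at hj0 hmax
  set t := X j0 / v j0
  have hl1 := h.one_lt
  have hLY : C.loop (t • v - X) = l • (t • v - X) := by
    rw [map_sub, map_smul, h.loop_eq, hX, smul_sub, smul_comm]
  have hlast : X C.last = 0 := by
    have := congrFun hX C.last
    rw [C.loop_last] at this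
    rcases mul_eq_zero.1 this.symm with h | h
    · linarith
    · exact h
  have hY : 0 ≤ t • v - X := by
    intro j
    by_cases hj : j = C.last
    · have : v C.last = 0 := h.onWall.1
      simp [hj, hlast, this]
    · have := (div_le_iff₀ (h.onWall.2 j hj)).1 (hmax j hj)
      simpa using this
  have hY0 : (t • v - X) j0 = 0 := by
    have := (h.onWall.2 j0 hj0).ne'
    simp [t, this]
  have hS : ∀ j ∈ C.switching, (t • v - X) j = 0 := by
    intro j hj
    by_contra hne
    have := C.loop_pos hY hj (lt_of_le_of_ne (hY j) (Ne.symm hne)) hj0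
    rw [hLY, Pi.smul_apply, hY0] at this
    simp at this
  have h1 := C.loop_of_switching_eq_zero hS
  rw [hLY] at h1
  refine ⟨t, ?_⟩
  ext j
  have h2 : l * (t • v - X) j = (t • v - X) j := congrFun h1 j
  have h3 : (l - 1) * (t • v - X) j = 0 := by linarith
  rcases mul_eq_zero.1 h3 with h | h
  · linarith
  · exact (sub_eq_zero.1 h).symm

end CyclicSystem

/-! ### Order intervals and projective asymptotics -/

namespace CyclicSystem

variable {ι : Type*} [DecidableEq ι] {C : CyclicSystem ι}

theorem cyc_le_cyc_of_not_switching {z : ι} (hz : z ∉ C.switching) {X : ι → ℝ} (hX : 0 ≤ X)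
    (p r : ℕ) : X z ≤ C.cyc p r X z := by
  induction r with
  | zero => exact le_rfl
  | succ r ih =>
    have h0 := C.cyc_nonneg p r hX
    rw [cyc_succ, C.step_apply_of_ne _ _ fun e => hz ⟨_, e.symm⟩]
    have := mul_nonneg (div_pos (C.g_pos (p + r) z) (C.g_pos (p + r) (C.m (p + r)))).le
      (h0 (C.m (p + r)))
    linarith

theorem OnWall.exists_smul_le [Fintype ι] {r : ℕ} {X Y : ι → ℝ} (hX : C.OnWall r X)
    (hY : C.OnWall r Y) : ∃ a : ℝ, 0 < a ∧ a • Y ≤ X := by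
  obtain ⟨j0, hj0, hmin⟩ := Finset.exists_min_image (Finset.univ.filter fun j => j ≠ C.m r)
    (fun j => X j / Y j) ⟨C.m (r + 1), by simp [C.m_succ_ne]⟩
  simp only [Finset.mem_filter, Finset.mem_univ, true_and] at hj0 hmin
  refine ⟨X j0 / Y j0, div_pos (hX.2 _ hj0) (hY.2 _ hj0), fun j => ?_⟩
  by_cases hj : j = C.m r
  · simp [hj, hX.1, hY.1]
  · exact (le_div_iff₀ (hY.2 j hj)).1 (hmin j hj)

theorem OnWall.exists_le_smul [Fintype ι] {r : ℕ} {X Y : ι → ℝ} (hX : C.OnWall r X)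
    (hY : C.OnWall r Y) : ∃ b : ℝ, 0 < b ∧ X ≤ b • Y := by
  obtain ⟨a, ha, h⟩ := hY.exists_smul_le hX
  refine ⟨a⁻¹, inv_pos.2 ha, fun j => ?_⟩
  have h1 := h j
  simp only [Pi.smul_apply, smul_eq_mul] at h1 ⊢
  rw [inv_mul_eq_div, le_div_iff₀ ha]
  linarith

theorem smul_le_cyc {a : ℝ} {X Y : ι → ℝ} (h : a • Y ≤ X) (p r : ℕ) :
    a • C.cyc p r Y ≤ C.cyc p r X := by
  rw [← map_smul]
  exact C.cyc_mono p r h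

theorem cyc_le_smul {b : ℝ} {X Y : ι → ℝ} (h : X ≤ b • Y) (p r : ℕ) :
    C.cyc p r X ≤ b • C.cyc p r Y := by
  rw [← map_smul]
  exact C.cyc_mono p r h

theorem abs_ratio_sub_le {ι : Type*} {X V : ι → ℝ} {a b : ℝ} (ha : 0 < a) (hV : 0 ≤ V)
    (h1 : a • V ≤ X) (h2 : X ≤ b • V) {z : ι} (hz : 0 < V z) (j : ι) :
    |X j / X z - V j / V z| ≤ (b / a - 1) * (V j / V z) := by
  have hab : a ≤ b := by
    have := (h1 z).trans (h2 z)
    exact le_of_mul_le_mul_right this hz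
  have hb : 0 < b := ha.trans_le hab
  have h1z : a * V z ≤ X z := h1 z
  have h2z : X z ≤ b * V z := h2 z
  have h1j : a * V j ≤ X j := h1 j
  have h2j : X j ≤ b * V j := h2 j
  have hXz : 0 < X z := (mul_pos ha hz).trans_le h1z
  have hVj : 0 ≤ V j := hV j
  have hR : 0 ≤ V j / V z := div_nonneg hVj hz.le
  have hup : X j / X z ≤ (b / a) * (V j / V z) := by
    rw [div_mul_div_comm]
    exact div_le_div₀ (by positivity) h2j (by positivity) h1z
  have hlo : (a / b) * (V j / V z) ≤ X j / X z := by
    rw [div_mul_div_comm]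
    exact div_le_div₀ ((mul_nonneg ha.le hVj).trans h1j) h1j hXz h2z
  -- Shows `1 - a / b ≤ b / a - 1`, so the error below is no larger than the error above.
  have hsum : 2 ≤ a / b + b / a := by
    rw [div_add_div _ _ hb.ne' ha.ne', le_div_iff₀ (by positivity)]
    nlinarith [sq_nonneg (a - b)]
  rw [abs_le]
  constructor
  · nlinarith
  · linarith

namespace IsPositiveEigenvector

variable {l : ℝ} {v : ι → ℝ} (h : C.IsPositiveEigenvector l v)

include h

theorem loop_pow (q : ℕ) : (C.loop ^ q) v = l ^ q • v := by
  induction q with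
  | zero => simp
  | succ q ih => rw [pow_succ', Module.End.mul_apply, ih, map_smul, h.loop_eq, smul_smul, pow_succ]

theorem cyc_mul_add (q r : ℕ) : C.cyc 0 (q * C.k + r) v = l ^ q • C.cyc 0 r v := by
  rw [CyclicSystem.cyc_mul_add, h.loop_pow, map_smul]

theorem pos_of_not_switching {z : ι} (hz : z ∉ C.switching) : 0 < v z :=
  h.onWall.2 z fun e => hz ⟨_, e.symm⟩

theorem cyc_pos {z : ι} (hz : z ∉ C.switching) (r : ℕ) : 0 < C.cyc 0 r v z :=
  (h.pos_of_not_switching hz).trans_le (cyc_le_cyc_of_not_switching hz h.onWall.nonneg 0 r)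

theorem ratio_mul_add (z : ι) (q r : ℕ) (j : ι) :
    C.cyc 0 (q * C.k + r) v j / C.cyc 0 (q * C.k + r) v z = C.cyc 0 r v j / C.cyc 0 r v z := by
  have : l ^ q ≠ 0 := pow_ne_zero _ (by linarith [h.one_lt])
  rw [h.cyc_mul_add, Pi.smul_apply, Pi.smul_apply, smul_eq_mul, smul_eq_mul,
    mul_div_mul_left _ _ this]

/-- A full turn multiplies the state by `l`, so the quotients are periodic in `r` and only finitely
many values occur. -/
theorem exists_ratio_le [Fintype ι] (z : ι) :
    ∃ K : ℝ, 0 < K ∧ ∀ r j, C.cyc 0 r v j / C.cyc 0 r v z ≤ K := by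
  obtain ⟨K, hK⟩ := (((Set.finite_Iio C.k).prod (Set.finite_univ (α := ι))).image
    (fun w : ℕ × ι => C.cyc 0 w.1 v w.2 / C.cyc 0 w.1 v z)).bddAbove
  refine ⟨max K 1, by positivity, fun r j => le_max_of_le_left ?_⟩
  have h1 := h.ratio_mul_add z (r / C.k) (r % C.k) j
  rw [Nat.div_add_mod'] at h1
  rw [h1]
  exact hK ⟨(r % C.k, j), ⟨Nat.mod_lt _ C.k_pos, trivial⟩, rfl⟩

/-- The loop sends the basis vector at a switching coordinate `l0` above `κ v`. Applied to `X - a v`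
and `b v - X`, this improves both bounds; the two gains add up to a fixed proportion of `b - a`,
because the `l0`-coordinates add up to `(b - a) v l0`. -/
theorem exists_contraction [Fintype ι] : ∃ η : ℝ, 0 < η ∧ η ≤ 1 ∧ ∀ (X : ι → ℝ) (a b : ℝ),
    a • v ≤ X → X ≤ b • v → ∃ a' b', a ≤ a' ∧ b' - a' ≤ (1 - η) * (b - a) ∧
      (a' * l) • v ≤ C.loop X ∧ C.loop X ≤ (b' * l) • v := by
  obtain ⟨l0, hl0, hl0'⟩ := C.exists_switching_ne_last
  have hl : 0 < l := by linarith [h.one_lt]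
  have hv0 : 0 < v l0 := h.onWall.2 l0 hl0'
  have he : C.OnWall (C.k - 1) (C.loop (Pi.single l0 1)) :=
    C.onWall_loop (Pi.single_nonneg.2 zero_le_one) hl0 (by simp)
  obtain ⟨κ', hκ', hle'⟩ := he.exists_smul_le h.onWall
  -- The cap `l / v l0` on `κ` ensures that `η = v l0 * κ / l` is at most `1`.
  obtain ⟨κ, hκ, hκ1, hle⟩ : ∃ κ : ℝ, 0 < κ ∧ κ ≤ l / v l0 ∧
      κ • v ≤ C.loop (Pi.single l0 1) :=
    ⟨min κ' (l / v l0), lt_min hκ' (div_pos hl hv0), min_le_right _ _,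
      (smul_le_smul_of_nonneg_right (min_le_left _ _) h.onWall.nonneg).trans hle'⟩
  have key : ∀ Y : ι → ℝ, 0 ≤ Y → (Y l0 * κ) • v ≤ C.loop Y := by
    intro Y hY
    have h1 : Y l0 • (Pi.single l0 1 : ι → ℝ) ≤ Y := by
      intro j
      by_cases hj : j = l0
      · subst hj; simp
      · simpa [hj] using hY j
    have h2 := C.loop_mono h1
    rw [map_smul] at h2
    rw [mul_smul]
    exact (smul_le_smul_of_nonneg_left hle (hY l0)).trans h2
  refine ⟨v l0 * κ / l, by positivity, ?_, fun X a b ha hb => ?_⟩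
  · rw [div_le_one hl]
    have := (le_div_iff₀ hv0).1 hκ1
    linarith
  refine ⟨a + (X l0 - a * v l0) * κ / l, b - (b * v l0 - X l0) * κ / l, ?_, ?_, ?_, ?_⟩
  · have : a * v l0 ≤ X l0 := ha l0
    have : 0 ≤ (X l0 - a * v l0) * κ / l :=
      div_nonneg (mul_nonneg (by linarith) hκ.le) hl.le
    linarith
  · apply le_of_eq
    field_simp
    ring
  · have h1 := key _ (sub_nonneg.2 ha)
    rw [map_sub, map_smul, h.loop_eq] at h1
    intro j
    have h2 := h1 j
    simp only [Pi.sub_apply, Pi.smul_apply, smul_eq_mul] at h2 ⊢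
    rw [add_mul, div_mul_cancel₀ _ hl.ne']
    linarith
  · have h1 := key _ (sub_nonneg.2 hb)
    rw [map_sub, map_smul, h.loop_eq] at h1
    intro j
    have h2 := h1 j
    simp only [Pi.sub_apply, Pi.smul_apply, smul_eq_mul] at h2 ⊢
    rw [sub_mul, div_mul_cancel₀ _ hl.ne']
    linarith

theorem exists_sandwich [Fintype ι] {X : ι → ℝ} (hX : C.OnWall (C.k - 1) X) :
    ∃ a₀ d ρ : ℝ, 0 < a₀ ∧ 0 ≤ ρ ∧ ρ < 1 ∧ ∀ q : ℕ, ∃ a b : ℝ, a₀ ≤ a ∧ b - a ≤ d * ρ ^ q ∧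
      (a * l ^ q) • v ≤ (C.loop ^ q) X ∧ (C.loop ^ q) X ≤ (b * l ^ q) • v := by
  obtain ⟨η, hη, hη1, hc⟩ := h.exists_contraction
  obtain ⟨a₀, ha₀, ha⟩ := hX.exists_smul_le h.onWall
  obtain ⟨b₀, -, hb⟩ := hX.exists_le_smul h.onWall
  refine ⟨a₀, b₀ - a₀, 1 - η, ha₀, by linarith, by linarith, fun q => ?_⟩
  induction q with
  | zero => exact ⟨a₀, b₀, le_rfl, by simp, by simpa using ha, by simpa using hb⟩
  | succ q ih =>
    have hlq : 0 < l ^ q := pow_pos (by linarith [h.one_lt]) _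
    obtain ⟨a, b, h1, h2, h3, h4⟩ := ih
    obtain ⟨a', b', h5, h6, h7, h8⟩ := hc _ _ _ h3 h4
    refine ⟨a' / l ^ q, b' / l ^ q, ?_, ?_, ?_, ?_⟩
    · rw [le_div_iff₀ hlq]
      exact (mul_le_mul_of_nonneg_right h1 hlq.le).trans h5
    · rw [← sub_div, div_le_iff₀ hlq]
      calc b' - a' ≤ (1 - η) * (b * l ^ q - a * l ^ q) := h6
        _ = (1 - η) * l ^ q * (b - a) := by ring
        _ ≤ (1 - η) * l ^ q * ((b₀ - a₀) * (1 - η) ^ q) :=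
            mul_le_mul_of_nonneg_left h2 (mul_nonneg (by linarith) hlq.le)
        _ = _ := by ring
    · rw [pow_succ' C.loop, pow_succ l, ← mul_assoc, div_mul_cancel₀ _ hlq.ne']
      exact h7
    · rw [pow_succ' C.loop, pow_succ l, ← mul_assoc, div_mul_cancel₀ _ hlq.ne']
      exact h8

/-- Projectively, all states converge to the cycle through the positive eigenvector. -/
theorem exists_abs_ratio_sub_lt [Fintype ι] {X : ι → ℝ} (hX : C.OnWall (C.k - 1) X) {z : ι}
    (hz : z ∉ C.switching) {ε : ℝ} (hε : 0 < ε) : ∃ R : ℕ, ∀ r, R ≤ r → ∀ j,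
      |C.cyc 0 r X j / C.cyc 0 r X z - C.cyc 0 r v j / C.cyc 0 r v z| < ε := by
  obtain ⟨a₀, d, ρ, ha₀, hρ0, hρ1, hs⟩ := h.exists_sandwich hX
  obtain ⟨K, hK, hKr⟩ := h.exists_ratio_le z
  have hlim : Filter.Tendsto (fun q : ℕ => d * ρ ^ q / a₀ * K) Filter.atTop (nhds 0) := by
    have := ((tendsto_pow_atTop_nhds_zero_of_lt_one hρ0 hρ1).const_mul d).div_const a₀
    simpa using this.mul_const K
  obtain ⟨Q, hQ⟩ := (hlim.eventually (gt_mem_nhds hε)).exists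
  obtain ⟨a, b, h1, h2, h3, h4⟩ := hs Q
  have hlq : 0 < l ^ Q := pow_pos (by linarith [h.one_lt]) _
  have ha : 0 < a := ha₀.trans_le h1
  have hv := h.onWall.nonneg
  refine ⟨Q * C.k, fun r hr j => ?_⟩
  obtain ⟨t, rfl⟩ := Nat.exists_eq_add_of_le hr
  have h5 := smul_le_cyc (C := C) h3 0 t
  have h6 := cyc_le_smul (C := C) h4 0 t
  rw [← CyclicSystem.cyc_mul_add, mul_smul, ← h.cyc_mul_add] at h5 h6
  have h7 := abs_ratio_sub_le ha (C.cyc_nonneg 0 _ hv) h5 h6 (h.cyc_pos hz _) j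
  have h0 : 0 ≤ C.cyc 0 (Q * C.k + t) v j / C.cyc 0 (Q * C.k + t) v z :=
    div_nonneg (C.cyc_nonneg 0 _ hv _) (h.cyc_pos hz _).le
  have hba : 0 ≤ b - a := by
    have h8 := (h5 z).trans (h6 z)
    have := le_of_mul_le_mul_right h8 (h.cyc_pos hz _)
    linarith
  refine (h7.trans ?_).trans_lt hQ
  have h9 : b / a - 1 = (b - a) / a := by field_simp
  rw [h9]
  refine mul_le_mul ?_ (hKr _ _) h0 ?_
  · exact div_le_div₀ (hba.trans h2) h2 ha₀ h1
  · exact div_nonneg (hba.trans h2) ha₀.le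

/-- The state dominates a multiple of `v`, which grows by `l > 1` per turn. For the coordinate of
the exponential of time, this says that switching times are unbounded. -/
theorem exists_lt_cyc [Fintype ι] {X : ι → ℝ} (hX : C.OnWall (C.k - 1) X) {z : ι}
    (hz : z ∉ C.switching) (B : ℝ) : ∃ r, B < C.cyc 0 r X z := by
  obtain ⟨a, ha, hle⟩ := hX.exists_smul_le h.onWall
  have hvz := h.pos_of_not_switching hz
  obtain ⟨q, hq⟩ := pow_unbounded_of_one_lt (B / (a * v z)) h.one_lt
  refine ⟨q * C.k + 0, ?_⟩
  have h1 := smul_le_cyc (C := C) hle 0 (q * C.k + 0) z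
  rw [h.cyc_mul_add] at h1
  rw [div_lt_iff₀ (by positivity)] at hq
  simp only [Pi.smul_apply, smul_eq_mul, cyc_zero] at h1
  linarith

end IsPositiveEigenvector

/-- If the Perron eigenvalue is at most `1`, the switching coordinates tend to `0` projectively. -/
theorem IsPerron.exists_ratio_lt [Fintype ι] {l : ℝ} {u : ι → ℝ} (h : C.IsPerron l u)
    (hl : l ≤ 1) {X : ι → ℝ} (hX : C.OnWall (C.k - 1) X) {z : ι} (hz : z ∉ C.switching) {ε : ℝ}
    (hε : 0 < ε) : ∃ R : ℕ, ∀ r, R ≤ r → ∀ j ∈ C.switching,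
      C.cyc 0 r X j / C.cyc 0 r X z < ε := by
  classical
  obtain ⟨l0, hl0, hl0'⟩ := C.exists_switching_ne_last
  -- A reference state whose iterates can be computed; any two states on the same wall bound each
  -- other up to positive factors.
  let U : ι → ℝ := fun j => if j ∈ C.switching then u j else 1
  have hUS : ∀ j ∈ C.switching, U j = u j := fun j hj => by simp [U, hj]
  have hU : C.OnWall (C.k - 1) U := by
    refine ⟨(hUS _ C.last_switching).trans h.last, fun j hj => ?_⟩
    by_cases hj' : j ∈ C.switching
    · rw [hUS j hj']; exact h.switching_pos j hj' hj
    · simp [U, hj']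
  set c := C.loop u z with hc
  have hc0 : 0 < c := C.loop_pos h.nonneg hl0 (h.switching_pos l0 hl0 hl0') fun e =>
    hz (e ▸ C.last_switching)
  have hpowS : ∀ q, ∀ j ∈ C.switching, (C.loop ^ q) U j = l ^ q * u j := by
    intro q
    induction q with
    | zero => intro j hj; simp [hUS j hj]
    | succ q ih =>
      intro j hj
      have h1 := C.cyc_congr_switching (X := (C.loop ^ q) U) (Y := l ^ q • u)
        (fun i hi => ih i hi) 0 C.k hj
      change C.loop _ j = C.loop _ j at h1
      rw [map_smul, Pi.smul_apply, h.loop_eq j hj] at h1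
      rw [pow_succ', Module.End.mul_apply, h1, smul_eq_mul, pow_succ, mul_assoc]
  -- Turn number `i` adds `c l ^ i`, which is at least `c l ^ q` for `i < q` as `l ≤ 1`. The factor
  -- `q` is what still gives decay of the quotients when `l = 1`.
  have hpowz : ∀ q : ℕ, 1 + c * q * l ^ q ≤ (C.loop ^ q) U z := by
    intro q
    induction q with
    | zero => simp [U, hz]
    | succ q ih =>
      have h1 := C.loop_of_switching_eq_zero (X := (C.loop ^ q) U - l ^ q • u)
        fun j hj => by simp [hpowS q j hj]
      have h2 := congrFun h1 z
      rw [map_sub, map_smul] at h2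
      simp only [Pi.sub_apply, Pi.smul_apply, smul_eq_mul, ← hc, h.not_switching z hz] at h2
      rw [pow_succ' C.loop, Module.End.mul_apply]
      have h3 : C.loop ((C.loop ^ q) U) z = (C.loop ^ q) U z + l ^ q * c := by linarith
      rw [h3]
      have hlq : 0 ≤ l ^ q := pow_nonneg h.pos.le q
      have h4 : l ^ (q + 1) ≤ l ^ q := pow_le_pow_of_le_one h.pos.le hl (Nat.le_succ q)
      have h5 : c * ((q : ℝ) + 1) * l ^ (q + 1) ≤ c * ((q : ℝ) + 1) * l ^ q :=
        mul_le_mul_of_nonneg_left h4 (by positivity)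
      push_cast
      linarith
  obtain ⟨K, hK⟩ := (((Set.finite_Iio C.k).prod (Set.finite_univ (α := ι))).image
    (fun w : ℕ × ι => C.cyc 0 w.1 U w.2)).bddAbove
  obtain ⟨a, ha, hle⟩ := hX.exists_smul_le hU
  obtain ⟨b, hb, hge⟩ := hX.exists_le_smul hU
  obtain ⟨Q, hQ⟩ := exists_nat_gt (b * K / (a * ε * c))
  refine ⟨Q * C.k, fun r hr j hj => ?_⟩
  set q := r / C.k with hq
  set t := r % C.k with ht
  have hr' : r = q * C.k + t := (Nat.div_add_mod' r C.k).symm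
  have hQq : Q ≤ q := (Nat.le_div_iff_mul_le C.k_pos).2 hr
  have hlq : 0 < l ^ q := pow_pos h.pos q
  have hlq1 : l ^ q ≤ 1 := pow_le_one₀ h.pos.le hl
  have hVj : C.cyc 0 r U j ≤ l ^ q * K := by
    rw [hr', cyc_mul_add, C.cyc_congr_switching (X := (C.loop ^ q) U) (Y := l ^ q • U)
      (fun i hi => by simp [hpowS q i hi, hUS i hi]) 0 t hj, map_smul, Pi.smul_apply, smul_eq_mul]
    exact mul_le_mul_of_nonneg_left (hK ⟨(t, j), ⟨Nat.mod_lt _ C.k_pos, trivial⟩, rfl⟩) hlq.le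
  have hVz : 1 + c * q * l ^ q ≤ C.cyc 0 r U z := by
    rw [hr', cyc_mul_add]
    refine (hpowz q).trans (cyc_le_cyc_of_not_switching hz ?_ 0 t)
    have := C.cyc_nonneg 0 (q * C.k + 0) hU.nonneg
    rwa [cyc_mul_add] at this
  have hXj : C.cyc 0 r X j ≤ b * C.cyc 0 r U j := cyc_le_smul hge 0 r j
  have hXz : a * C.cyc 0 r U z ≤ C.cyc 0 r X z := smul_le_cyc hle 0 r z
  have hXz' : a * (1 + c * q * l ^ q) ≤ C.cyc 0 r X z :=
    (mul_le_mul_of_nonneg_left hVz ha.le).trans hXz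
  have hpos : 0 < C.cyc 0 r X z := lt_of_lt_of_le (by positivity) hXz'
  rw [div_lt_iff₀ hpos]
  rw [div_lt_iff₀ (by positivity)] at hQ
  have hQq' : (Q : ℝ) ≤ q := by exact_mod_cast hQq
  calc C.cyc 0 r X j ≤ b * (l ^ q * K) := hXj.trans (mul_le_mul_of_nonneg_left hVj hb.le)
    _ = (b * K) * l ^ q := by ring
    _ < Q * (a * ε * c) * l ^ q := mul_lt_mul_of_pos_right hQ hlq
    _ ≤ q * (a * ε * c) * l ^ q := by gcongr
    _ ≤ ε * (a * (1 + c * q * l ^ q)) := by nlinarith [mul_pos hε ha]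
    _ ≤ _ := mul_le_mul_of_nonneg_left hXz' hε.le

end CyclicSystem

/-! ### Signs and cyclic indices -/

/-- The sign `±1` encoded by a Boolean. -/
noncomputable def boolSign (b : Bool) : ℝ := if b = true then 1 else -1

theorem boolSign_mul_self (b : Bool) : boolSign b * boolSign b = 1 := by
  cases b <;> simp [boolSign]

theorem boolSign_not (b : Bool) : boolSign (!b) = -boolSign b := by
  cases b <;> simp [boolSign]

theorem boolSign_mul_mul (b : Bool) (x : ℝ) : boolSign b * (boolSign b * x) = x := by
  rw [← mul_assoc, boolSign_mul_self, one_mul]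

theorem abs_boolSign_mul (b : Bool) (x : ℝ) : |boolSign b * x| = |x| := by
  cases b <;> simp [boolSign]

theorem boolSign_eq_of_pos {b c : Bool} {x : ℝ} (hb : 0 < boolSign b * x)
    (hc : 0 ≤ boolSign c * x) : b = c := by
  cases b <;> cases c <;> simp [boolSign] at hb hc ⊢ <;> linarith

theorem eq_zero_of_boolSign {b : Bool} {x : ℝ} (h : 0 ≤ boolSign b * x)
    (h' : 0 ≤ boolSign (!b) * x) : x = 0 := by
  rw [boolSign_not] at h'
  have h0 : boolSign b * x = 0 := by linarith
  rw [← boolSign_mul_mul b x, h0, mul_zero]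

theorem Fin.ofNat_succ' (k : ℕ) [NeZero k] (r : ℕ) : Fin.ofNat k (r + 1) = Fin.ofNat k r + 1 := by
  ext
  simp [Fin.val_add, Fin.ofNat]

theorem Fin.ofNat_add_self (k : ℕ) [NeZero k] (r : ℕ) : Fin.ofNat k (r + k) = Fin.ofNat k r := by
  ext
  simp [Fin.ofNat]

theorem Fin.ofNat_mul_add (k : ℕ) [NeZero k] (q r : ℕ) :
    Fin.ofNat k (q * k + r) = Fin.ofNat k r := by
  ext
  simp [Fin.ofNat]

/-! ### From the network to a cyclic system -/

namespace BinaryGlassNetwork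

variable {n k : ℕ} [NeZero k] {N : BinaryGlassNetwork n} {O : Fin k → Fin n → Bool}
  {s : Fin k → Fin n}

theorem onSide_iff (i : Fin n) (b : Bool) (a : ℝ) :
    N.OnSide i b a ↔ 0 < boolSign b * (a - N.θ i) := by
  cases b <;> simp [OnSide, boolSign]

theorem flow_sub_threshold (σ : Fin n → Bool) (x : Fin n → ℝ) (t : ℝ) (j : Fin n) :
    N.flow σ x t j - N.θ j =
      (1 - Real.exp (-t)) * (N.focal σ j - N.θ j) + Real.exp (-t) * (x j - N.θ j) := by
  simp only [flow, Pi.add_apply, Pi.smul_apply, Pi.sub_apply, smul_eq_mul]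
  ring

theorem flow_zero (σ : Fin n → Bool) (x : Fin n → ℝ) : N.flow σ x 0 = x := by
  simp [flow]

theorem flow_flow (σ : Fin n → Bool) (x : Fin n → ℝ) (a b : ℝ) :
    N.flow σ (N.flow σ x a) b = N.flow σ x (a + b) := by
  simp only [flow, add_sub_cancel_left, smul_smul, ← Real.exp_add]
  rw [neg_add, add_comm (-b)]

theorem continuous_flow (σ : Fin n → Bool) (x : Fin n → ℝ) : Continuous (N.flow σ x) := by
  unfold flow
  fun_prop

theorem hasDerivAt_flow (σ : Fin n → Bool) (x : Fin n → ℝ) (a t : ℝ) :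
    HasDerivAt (fun t => N.flow σ x (t - a)) (N.focal σ - N.flow σ x (t - a)) t := by
  unfold flow
  have h1 : HasDerivAt (fun t : ℝ => Real.exp (-(t - a))) (-Real.exp (-(t - a))) t := by
    have := (((hasDerivAt_id t).sub_const a).neg).exp
    simpa using this
  have h2 := (h1.smul_const (x - N.focal σ)).const_add (N.focal σ)
  refine h2.congr_deriv ?_
  rw [neg_smul]
  abel

namespace IsCyclicAttractor

theorem apply_of_ne (hC : N.IsCyclicAttractor O s) {i : Fin k} {j : Fin n} (h : j ≠ s i) :
    O (i + 1) j = O i j := by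
  rw [hC.adjacent i, Function.update_of_ne h]

theorem apply_self (hC : N.IsCyclicAttractor O s) (i : Fin k) : O (i + 1) (s i) = !(O i (s i)) := by
  rw [hC.adjacent i, Function.update_self]

/-- The focal point of a region of the cycle lies in the next region. -/
theorem focal_side (hC : N.IsCyclicAttractor O s) (i : Fin k) (j : Fin n) :
    0 < boolSign (O (i + 1) j) * (N.focal (O i) j - N.θ j) := by
  by_cases hj : j = s i
  · subst hj
    exact (onSide_iff _ _ _).1 (hC.towards i)
  rw [hC.apply_of_ne hj]
  by_contra hneg
  have hne : ∀ j, N.focal (O i) j - N.θ j ≠ 0 := fun j => sub_ne_zero.2 (N.focal_ne _ j)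
  have hsn : ∀ b : Bool, boolSign b ≠ 0 := fun b => by cases b <;> simp [boolSign]
  -- If coordinate `j` also headed out of the orthant, start at the mirror image of the focal point
  -- in all outgoing coordinates. They reach their thresholds together, at `e^{-t} = 1/2`, so the
  -- exit is not in the relatively open wall.
  let x : Fin n → ℝ := fun l =>
    if 0 < boolSign (O i l) * (N.focal (O i) l - N.θ l) then N.focal (O i) l
    else 2 * N.θ l - N.focal (O i) l
  have hx : x ∈ N.region (O i) := by
    intro l
    rw [onSide_iff]
    simp only [x]
    split_ifs with h
    · exact h
    · have h1 : boolSign (O i l) * (N.focal (O i) l - N.θ l) < 0 :=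
        lt_of_le_of_ne (not_lt.1 h) (mul_ne_zero (hsn _) (hne l))
      nlinarith
  obtain ⟨t, -, -, ht⟩ := hC.enters i x hx
  have hm : ¬ 0 < boolSign (O i (s i)) * (N.focal (O i) (s i) - N.θ (s i)) := by
    have := (onSide_iff _ _ _).1 (hC.towards i)
    rw [hC.apply_self, boolSign_not] at this
    linarith
  have h1 := N.flow_sub_threshold (O i) x t (s i)
  rw [ht.1] at h1
  simp only [x, if_neg hm] at h1
  have h2 : Real.exp (-t) = 1 / 2 := by
    have : (N.focal (O i) (s i) - N.θ (s i)) * (1 - 2 * Real.exp (-t)) = 0 := by linarith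
    rcases mul_eq_zero.1 this with h | h
    · exact absurd h (hne _)
    · linarith
  have h3 := (onSide_iff _ _ _).1 (ht.2 j hj)
  rw [flow_sub_threshold, h2] at h3
  simp only [x, if_neg hneg] at h3
  ring_nf at h3
  exact lt_irrefl _ h3

/-- A second switch of the same variable would put the focal point of `O (i + 1)` on the side that
`away` excludes. -/
theorem switch_ne (hC : N.IsCyclicAttractor O s) (i : Fin k) : s (i + 1) ≠ s i := by
  intro h
  have h1 := hC.focal_side (i + 1) (s i)
  have h2 := (onSide_iff _ _ _).1 (hC.away i)
  have h3 := hC.apply_self (i + 1)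
  rw [h] at h3
  rw [h3, boolSign_not] at h1
  linarith

/-- The cycle in absolute coordinates; the coordinate `none` is the exponential of the time. -/
noncomputable def system (hC : N.IsCyclicAttractor O s) : CyclicSystem (Option (Fin n)) where
  k := k
  g r
    | none => 1
    | some j => boolSign (O (Fin.ofNat k r + 1) j) * (N.focal (O (Fin.ofNat k r)) j - N.θ j)
  m r := some (s (Fin.ofNat k r))
  k_pos := Nat.pos_of_ne_zero (NeZero.ne k)
  g_pos r j := by
    cases j with
    | none => exact one_pos
    | some j => exact hC.focal_side _ j
  m_succ_ne r h := by
    rw [Fin.ofNat_succ'] at h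
    exact hC.switch_ne _ (Option.some_injective _ h)
  g_add r := by simp only [Fin.ofNat_add_self]
  m_add r := by simp only [Fin.ofNat_add_self]

theorem none_not_switching (hC : N.IsCyclicAttractor O s) : none ∉ hC.system.switching := by
  rintro ⟨r, hr⟩
  cases hr

theorem some_switching_iff (hC : N.IsCyclicAttractor O s) (j : Fin n) :
    some j ∈ hC.system.switching ↔ ∃ i, s i = j := by
  constructor
  · rintro ⟨r, hr⟩
    exact ⟨_, Option.some_injective _ hr⟩
  · rintro ⟨i, rfl⟩
    exact ⟨i.val, by simp [system]⟩

end IsCyclicAttractor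

/-- The absolute coordinates of a point with respect to an orthant, at time `0`. -/
noncomputable def lift (N : BinaryGlassNetwork n) (σ : Fin n → Bool) (x : Fin n → ℝ) :
    Option (Fin n) → ℝ
  | none => 1
  | some j => boolSign (σ j) * (x j - N.θ j)

/-- The point with given absolute coordinates. -/
noncomputable def point (N : BinaryGlassNetwork n) (σ : Fin n → Bool) (X : Option (Fin n) → ℝ) :
    Fin n → ℝ :=
  fun j => N.θ j + boolSign (σ j) * (X (some j) / X none)

@[simp] theorem lift_none (σ : Fin n → Bool) (x : Fin n → ℝ) : N.lift σ x none = 1 := rfl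

theorem lift_some (σ : Fin n → Bool) (x : Fin n → ℝ) (j : Fin n) :
    N.lift σ x (some j) = boolSign (σ j) * (x j - N.θ j) := rfl

theorem point_lift (σ : Fin n → Bool) (x : Fin n → ℝ) : N.point σ (N.lift σ x) = x := by
  ext j
  simp only [point, lift, div_one, boolSign_mul_mul]
  ring

theorem point_sub (σ : Fin n → Bool) (X : Option (Fin n) → ℝ) (j : Fin n) :
    boolSign (σ j) * (N.point σ X j - N.θ j) = X (some j) / X none := by
  rw [point, add_sub_cancel_left, boolSign_mul_mul]

theorem point_smul (σ : Fin n → Bool) (X : Option (Fin n) → ℝ) {c : ℝ} (hc : c ≠ 0) :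
    N.point σ (c • X) = N.point σ X := by
  ext j
  simp only [point, Pi.smul_apply, smul_eq_mul, mul_div_mul_left _ _ hc]

theorem smul_lift_point (σ : Fin n → Bool) {X : Option (Fin n) → ℝ} (hX : X none ≠ 0) :
    X none • N.lift σ (N.point σ X) = X := by
  ext j
  cases j with
  | none => simp
  | some j =>
    rw [Pi.smul_apply, lift_some, point_sub, smul_eq_mul, mul_div_cancel₀ _ hX]

/-- Membership in a piece of the cycle. -/
theorem mem_piece_iff {i : Fin k} {x : Fin n → ℝ} : x ∈ N.piece O s i ↔
    (∀ j, j ≠ s (i - 1) → 0 < boolSign (O i j) * (x j - N.θ j)) ∧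
      0 ≤ boolSign (O i (s (i - 1))) * (x (s (i - 1)) - N.θ (s (i - 1))) := by
  simp only [piece, Set.mem_union, region, wall, Set.mem_ofPred_eq, onSide_iff]
  constructor
  · rintro (h | ⟨h, h'⟩)
    · exact ⟨fun j _ => h j, (h _).le⟩
    · exact ⟨h', by simp [h]⟩
  · rintro ⟨h, h'⟩
    rcases h'.eq_or_lt with h0 | h0
    · refine Or.inr ⟨?_, h⟩
      have := boolSign_mul_mul (O i (s (i - 1))) (x (s (i - 1)) - N.θ (s (i - 1)))
      rw [← h0, mul_zero] at this
      linarith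
    · refine Or.inl fun j => ?_
      by_cases hj : j = s (i - 1)
      · rw [hj]; exact h0
      · exact h j hj

/-- The factor by which `exp t` grows until the exit from the region `O i`. -/
noncomputable def exitFactor (N : BinaryGlassNetwork n) (O : Fin k → Fin n → Bool)
    (s : Fin k → Fin n) (i : Fin k) (x : Fin n → ℝ) : ℝ :=
  1 + boolSign (O i (s i)) * (x (s i) - N.θ (s i)) /
    (boolSign (O (i + 1) (s i)) * (N.focal (O i) (s i) - N.θ (s i)))

namespace IsCyclicAttractor

theorem switch_ne_prev (hC : N.IsCyclicAttractor O s) (i : Fin k) : s i ≠ s (i - 1) := by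
  have := hC.switch_ne (i - 1)
  rwa [sub_add_cancel] at this

theorem piece_pos (hC : N.IsCyclicAttractor O s) {i : Fin k} {x : Fin n → ℝ}
    (hx : x ∈ N.piece O s i) : 0 < boolSign (O i (s i)) * (x (s i) - N.θ (s i)) :=
  (mem_piece_iff.1 hx).1 _ (hC.switch_ne_prev i)

theorem piece_nonneg (_ : N.IsCyclicAttractor O s) {i : Fin k} {x : Fin n → ℝ}
    (hx : x ∈ N.piece O s i) (j : Fin n) : 0 ≤ boolSign (O i j) * (x j - N.θ j) := by
  by_cases hj : j = s (i - 1)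
  · rw [hj]; exact (mem_piece_iff.1 hx).2
  · exact ((mem_piece_iff.1 hx).1 j hj).le

theorem one_lt_exitFactor (hC : N.IsCyclicAttractor O s) {i : Fin k} {x : Fin n → ℝ}
    (hx : x ∈ N.piece O s i) : 1 < N.exitFactor O s i x := by
  have := div_pos (hC.piece_pos hx) (hC.focal_side i (s i))
  rw [exitFactor]
  linarith

theorem flow_mem_piece (hC : N.IsCyclicAttractor O s) {i : Fin k} {x : Fin n → ℝ}
    (hx : x ∈ N.piece O s i) {t : ℝ} (ht : 0 ≤ t) (ht' : Real.exp t < N.exitFactor O s i x) :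
    N.flow (O i) x t ∈ N.piece O s i := by
  have he : 0 < Real.exp (-t) := Real.exp_pos _
  have he1 : Real.exp (-t) ≤ 1 := by simpa using ht
  have hee : Real.exp (-t) * Real.exp t = 1 := by rw [← Real.exp_add]; simp
  have hf : ∀ j, j ≠ s i → 0 < boolSign (O i j) * (N.focal (O i) j - N.θ j) := fun j hj => by
    rw [← hC.apply_of_ne hj]; exact hC.focal_side i j
  rw [mem_piece_iff] at hx ⊢
  refine ⟨fun j hj => ?_, ?_⟩
  · rw [flow_sub_threshold]
    have h1 := hx.1 j hj
    by_cases hj' : j = s i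
    · subst hj'
      have h2 := hC.focal_side i (s i)
      rw [exitFactor, ← sub_lt_iff_lt_add', lt_div_iff₀ h2] at ht'
      rw [hC.apply_self, boolSign_not] at ht'
      have h3 := mul_lt_mul_of_pos_left ht' he
      rw [← mul_assoc, mul_sub, hee, mul_one] at h3
      linarith
    · have h2 := mul_nonneg (sub_nonneg.2 he1) (hf j hj').le
      have h3 := mul_pos he h1
      nlinarith
  · rw [flow_sub_threshold]
    have h2 := mul_nonneg (sub_nonneg.2 he1) (hf _ (hC.switch_ne_prev i).symm).le
    have h3 := mul_nonneg he.le hx.2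
    nlinarith

/-- After leaving its wall, the flow of `O i` is strictly inside the region. -/
theorem flow_pos_of_wall (hC : N.IsCyclicAttractor O s) {i : Fin k} {x : Fin n → ℝ}
    (hx : x ∈ N.piece O s i) {t : ℝ} (ht : 0 < t) :
    0 < boolSign (O i (s (i - 1))) * (N.flow (O i) x t (s (i - 1)) - N.θ (s (i - 1))) := by
  have he : 0 < Real.exp (-t) := Real.exp_pos _
  have he1 : Real.exp (-t) < 1 := by simpa using ht
  have hf : 0 < boolSign (O i (s (i - 1))) * (N.focal (O i) (s (i - 1)) - N.θ (s (i - 1))) := by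
    rw [← hC.apply_of_ne (hC.switch_ne_prev i).symm]; exact hC.focal_side i _
  rw [flow_sub_threshold]
  have h2 := mul_pos (sub_pos.2 he1) hf
  have h3 := mul_nonneg he.le (hC.piece_nonneg hx (s (i - 1)))
  nlinarith

/-- A point of a piece of the cycle that is in the closed orthant `O i` lies in the `i`-th piece or
on the wall by which the orthant is left. -/
theorem eq_or_of_mem_piece (hC : N.IsCyclicAttractor O s) {i j : Fin k} {x : Fin n → ℝ}
    (hx : x ∈ N.piece O s j) (hi : ∀ l, 0 ≤ boolSign (O i l) * (x l - N.θ l)) :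
    i = j ∨ (i = j - 1 ∧ x (s (j - 1)) = N.θ (s (j - 1))) := by
  have hne : ∀ l, l ≠ s (j - 1) → O i l = O j l := fun l hl =>
    (boolSign_eq_of_pos ((mem_piece_iff.1 hx).1 l hl) (hi l)).symm
  by_cases he : O i (s (j - 1)) = O j (s (j - 1))
  · left
    refine hC.injective (funext fun l => ?_)
    by_cases hl : l = s (j - 1)
    · rw [hl, he]
    · exact hne l hl
  · right
    have hself := hC.apply_self (j - 1)
    rw [sub_add_cancel] at hself
    have hflip : O i (s (j - 1)) = O (j - 1) (s (j - 1)) := by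
      rw [hself] at he
      revert he
      cases O i (s (j - 1)) <;> cases O (j - 1) (s (j - 1)) <;> simp
    constructor
    · refine hC.injective (funext fun l => ?_)
      by_cases hl : l = s (j - 1)
      · rw [hl, hflip]
      · have := hC.apply_of_ne hl
        rw [sub_add_cancel] at this
        rw [hne l hl, this]
    · have h1 := hi (s (j - 1))
      have h2 := hC.piece_nonneg hx (s (j - 1))
      rw [hflip] at h1
      rw [hself] at h2
      linarith [eq_zero_of_boolSign h1 h2]

theorem piece_unique (hC : N.IsCyclicAttractor O s) {i j : Fin k} {x : Fin n → ℝ}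
    (hi : x ∈ N.piece O s i) (hj : x ∈ N.piece O s j) : i = j := by
  rcases hC.eq_or_of_mem_piece hj (hC.piece_nonneg hi) with h | ⟨h, h0⟩
  · exact h
  · rw [← h] at h0
    have := hC.piece_pos hi
    rw [h0] at this
    simp at this

end IsCyclicAttractor

end BinaryGlassNetwork

/-! ### The canonical trajectory -/

namespace BinaryGlassNetwork.IsCyclicAttractor

variable {n k : ℕ} [NeZero k] {N : BinaryGlassNetwork n} {O : Fin k → Fin n → Bool}
  {s : Fin k → Fin n} (hC : N.IsCyclicAttractor O s)

include hC

theorem none_ne_m (r : ℕ) : none ≠ hC.system.m r := fun h => Option.some_ne_none _ h.symm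

/-- The growth factor of `none` is the growth of `e^t` during the crossing, so the logarithm of this
coordinate accumulates elapsed time. -/
theorem step_none (r : ℕ) {X : Option (Fin n) → ℝ} (hX : X none ≠ 0) :
    hC.system.step r X none =
      X none * N.exitFactor O s (Fin.ofNat k r) (N.point (O (Fin.ofNat k r)) X) := by
  have hg := (hC.focal_side (Fin.ofNat k r) (s (Fin.ofNat k r))).ne'
  rw [hC.system.step_apply_of_ne r X (hC.none_ne_m r), exitFactor, point_sub]
  simp only [system]
  field_simp

theorem step_some (r : ℕ) (X : Option (Fin n) → ℝ) {j : Fin n} (hj : j ≠ s (Fin.ofNat k r)) :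
    hC.system.step r X (some j) = X (some j) +
      boolSign (O (Fin.ofNat k r + 1) j) * (N.focal (O (Fin.ofNat k r)) j - N.θ j) /
      (boolSign (O (Fin.ofNat k r + 1) (s (Fin.ofNat k r))) *
        (N.focal (O (Fin.ofNat k r)) (s (Fin.ofNat k r)) - N.θ (s (Fin.ofNat k r)))) *
      X (some (s (Fin.ofNat k r))) :=
  hC.system.step_apply_of_ne r X fun h => hj (Option.some_injective _ h)

theorem step_self (r : ℕ) (X : Option (Fin n) → ℝ) :
    hC.system.step r X (some (s (Fin.ofNat k r))) = 0 :=
  hC.system.step_apply_self r X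

/-- The flow of a region reaches the exit wall at the point given by the linear step. -/
theorem flow_point (r : ℕ) {X : Option (Fin n) → ℝ} (hX : X none ≠ 0) {t : ℝ}
    (ht : Real.exp t = N.exitFactor O s (Fin.ofNat k r) (N.point (O (Fin.ofNat k r)) X)) :
    N.flow (O (Fin.ofNat k r)) (N.point (O (Fin.ofNat k r)) X) t =
      N.point (O (Fin.ofNat k (r + 1))) (hC.system.step r X) := by
  set i := Fin.ofNat k r with hi
  have hg : boolSign (O (i + 1) (s i)) * (N.focal (O i) (s i) - N.θ (s i)) ≠ 0 :=
    (hC.focal_side i (s i)).ne'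
  have he : 0 < N.exitFactor O s i (N.point (O i) X) := ht ▸ Real.exp_pos t
  have hnone := hC.step_none r hX
  rw [← hi] at hnone
  have hen : Real.exp (-t) = (N.exitFactor O s i (N.point (O i) X))⁻¹ := by
    rw [Real.exp_neg, ht]
  ext j
  have hL := N.flow_sub_threshold (O i) (N.point (O i) X) t j
  have hpj : N.point (O i) X j - N.θ j = boolSign (O i j) * (X (some j) / X none) := by
    rw [point, add_sub_cancel_left]
  rw [hen, hpj] at hL
  have hef : N.exitFactor O s i (N.point (O i) X) - 1 = X (some (s i)) / X none /
      (boolSign (O (i + 1) (s i)) * (N.focal (O i) (s i) - N.θ (s i))) := by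
    rw [exitFactor, point_sub, add_sub_cancel_left]
  set e := N.exitFactor O s i (N.point (O i) X) with he'
  rw [← sub_left_inj (a := N.θ j), hL, point, add_sub_cancel_left, hnone, Fin.ofNat_succ', ← hi]
  by_cases hj : j = s i
  · subst hj
    rw [hi, hC.step_self, ← hi, zero_div, mul_zero]
    have h1 : (e - 1) * (N.focal (O i) (s i) - N.θ (s i)) =
        -(boolSign (O i (s i)) * (X (some (s i)) / X none)) := by
      rw [hef]
      rw [hC.apply_self, boolSign_not] at hg ⊢
      have h2 : boolSign (O i (s i)) ≠ 0 := by
        intro h; simp [h] at hg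
      have h3 : N.focal (O i) (s i) - N.θ (s i) ≠ 0 := by
        intro h; simp [h] at hg
      have h4 := boolSign_mul_self (O i (s i))
      field_simp
      rw [pow_two, h4, mul_one]
    have h5 : (1 - e⁻¹) = e⁻¹ * (e - 1) := by field_simp
    rw [h5, mul_assoc, h1]
    ring
  · rw [hC.step_some r X hj, ← hi, hC.apply_of_ne hj]
    have h5 : (1 - e⁻¹) = e⁻¹ * (e - 1) := by field_simp
    have h4 := boolSign_mul_self (O i j)
    rw [h5, hef]
    set G := boolSign (O (i + 1) (s i)) * (N.focal (O i) (s i) - N.θ (s i))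
    field_simp
    linear_combination (-(X (some (s i)) * (N.focal (O i) j - N.θ j))) * h4

/-- The absolute coordinates of the `r`-th switching point after the start at `x` in piece `p`. -/
noncomputable def state (p : ℕ) (x : Fin n → ℝ) (r : ℕ) : Option (Fin n) → ℝ :=
  hC.system.cyc p r (N.lift (O (Fin.ofNat k p)) x)

/-- The time of the `r`-th switching. -/
noncomputable def time (p : ℕ) (x : Fin n → ℝ) (r : ℕ) : ℝ := Real.log (hC.state p x r none)

/-- The `r`-th switching point. -/
noncomputable def pos (p : ℕ) (x : Fin n → ℝ) (r : ℕ) : Fin n → ℝ :=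
  N.point (O (Fin.ofNat k (p + r))) (hC.state p x r)

theorem time_zero (p : ℕ) (x : Fin n → ℝ) : hC.time p x 0 = 0 := by simp [time, state]

theorem pos_zero (p : ℕ) (x : Fin n → ℝ) : hC.pos p x 0 = x := point_lift _ _

theorem point_mem_piece {r : ℕ} {X : Option (Fin n) → ℝ} (hX : hC.system.OnWall r X) :
    N.point (O (Fin.ofNat k (r + 1))) X ∈ N.piece O s (Fin.ofNat k (r + 1)) := by
  have hn : 0 < X none := hX.2 _ (hC.none_ne_m r)
  rw [mem_piece_iff]
  simp only [point_sub]
  rw [Fin.ofNat_succ', add_sub_cancel_right]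
  refine ⟨fun j hj => div_pos (hX.2 _ fun h => hj (Option.some_injective _ h)) hn, ?_⟩
  have : X (some (s (Fin.ofNat k r))) = 0 := hX.1
  rw [this, zero_div]

section

variable {p : ℕ} {x : Fin n → ℝ} (hx : x ∈ N.piece O s (Fin.ofNat k p))

include hx

theorem lift_nonneg : 0 ≤ N.lift (O (Fin.ofNat k p)) x := by
  intro j
  cases j with
  | none => exact zero_le_one
  | some j => exact hC.piece_nonneg hx j

theorem lift_pos : 0 < N.lift (O (Fin.ofNat k p)) x (hC.system.m p) := hC.piece_pos hx

theorem state_onWall (r : ℕ) : hC.system.OnWall (p + r) (hC.state p x (r + 1)) :=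
  hC.system.onWall_cyc (hC.lift_nonneg hx) (hC.lift_pos hx) r

theorem one_le_state_none (r : ℕ) : 1 ≤ hC.state p x r none :=
  CyclicSystem.cyc_le_cyc_of_not_switching hC.none_not_switching (hC.lift_nonneg hx) p r

theorem pos_mem (r : ℕ) : hC.pos p x r ∈ N.piece O s (Fin.ofNat k (p + r)) := by
  cases r with
  | zero => rw [pos_zero]; exact hx
  | succ r => exact hC.point_mem_piece (hC.state_onWall hx r)

theorem pos_succ_eq (r : ℕ) : hC.pos p x (r + 1) (s (Fin.ofNat k (p + r))) =
    N.θ (s (Fin.ofNat k (p + r))) := by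
  have : hC.state p x (r + 1) (some (s (Fin.ofNat k (p + r)))) = 0 := (hC.state_onWall hx r).1
  rw [pos, point, this]
  simp

theorem exp_time (r : ℕ) : Real.exp (hC.time p x r) = hC.state p x r none :=
  Real.exp_log (zero_lt_one.trans_le (hC.one_le_state_none hx r))

theorem exp_time_sub (r : ℕ) : Real.exp (hC.time p x (r + 1) - hC.time p x r) =
    N.exitFactor O s (Fin.ofNat k (p + r)) (hC.pos p x r) := by
  have h0 := (zero_lt_one.trans_le (hC.one_le_state_none hx r)).ne'
  rw [Real.exp_sub, hC.exp_time hx, hC.exp_time hx]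
  have : hC.state p x (r + 1) none = hC.state p x r none *
    N.exitFactor O s (Fin.ofNat k (p + r)) (hC.pos p x r) := hC.step_none (p + r) h0
  rw [this, mul_div_cancel_left₀ _ h0]

theorem time_lt_succ (r : ℕ) : hC.time p x r < hC.time p x (r + 1) := by
  have h := hC.one_lt_exitFactor (hC.pos_mem hx r)
  rw [← hC.exp_time_sub hx, Real.one_lt_exp_iff] at h
  linarith

theorem time_strictMono : StrictMono (hC.time p x) := strictMono_nat_of_lt_succ (hC.time_lt_succ hx)

theorem time_nonneg (r : ℕ) : 0 ≤ hC.time p x r := by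
  rw [← hC.time_zero p x]
  exact (hC.time_strictMono hx).monotone (Nat.zero_le r)

theorem flow_pos (r : ℕ) : N.flow (O (Fin.ofNat k (p + r))) (hC.pos p x r)
    (hC.time p x (r + 1) - hC.time p x r) = hC.pos p x (r + 1) :=
  hC.flow_point (p + r) (zero_lt_one.trans_le (hC.one_le_state_none hx r)).ne'
    (hC.exp_time_sub hx r)

theorem flow_mem (r : ℕ) {t : ℝ} (ht : hC.time p x r ≤ t) (ht' : t < hC.time p x (r + 1)) :
    N.flow (O (Fin.ofNat k (p + r))) (hC.pos p x r) (t - hC.time p x r) ∈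
      N.piece O s (Fin.ofNat k (p + r)) := by
  refine hC.flow_mem_piece (hC.pos_mem hx r) (sub_nonneg.2 ht) ?_
  rw [← hC.exp_time_sub hx]
  exact Real.exp_lt_exp.2 (by linarith)

end

theorem exists_time_mem {p : ℕ} {x : Fin n → ℝ} {t : ℝ} (ht : 0 ≤ t) {r : ℕ} (hr : t < hC.time p x r) :
    ∃ q, hC.time p x q ≤ t ∧ t < hC.time p x (q + 1) := by
  classical
  have hex : ∃ r, t < hC.time p x r := ⟨r, hr⟩
  have h0 : Nat.find hex ≠ 0 := fun h => by
    have := Nat.find_spec hex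
    rw [h, hC.time_zero] at this
    linarith
  obtain ⟨q, hq⟩ := Nat.exists_eq_succ_of_ne_zero h0
  refine ⟨q, not_lt.1 (Nat.find_min hex (by omega)), ?_⟩
  have := Nat.find_spec hex
  rwa [hq] at this

open Classical in
/-- The canonical trajectory through `x`. -/
noncomputable def sol (p : ℕ) (x : Fin n → ℝ) (t : ℝ) : Fin n → ℝ :=
  if h : ∃ r, t < hC.time p x (r + 1) then
    N.flow (O (Fin.ofNat k (p + Nat.find h))) (hC.pos p x (Nat.find h))
      (t - hC.time p x (Nat.find h))
  else x

/-- The end of the life of the canonical trajectory. -/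
noncomputable def endTime (p : ℕ) (x : Fin n → ℝ) : EReal := ⨆ r, (hC.time p x r : EReal)

theorem lt_endTime_iff (p : ℕ) (x : Fin n → ℝ) (t : ℝ) :
    (t : EReal) < hC.endTime p x ↔ ∃ r, t < hC.time p x r := by
  rw [endTime, lt_iSup_iff]
  simp only [EReal.coe_lt_coe_iff]

section

variable {p : ℕ} {x : Fin n → ℝ} (hx : x ∈ N.piece O s (Fin.ofNat k p))

include hx

theorem sol_eq_of_lt (r : ℕ) {t : ℝ} (ht : hC.time p x r ≤ t) (ht' : t < hC.time p x (r + 1)) :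
    hC.sol p x t =
      N.flow (O (Fin.ofNat k (p + r))) (hC.pos p x r) (t - hC.time p x r) := by
  classical
  have hex : ∃ r, t < hC.time p x (r + 1) := ⟨r, ht'⟩
  have hfind : Nat.find hex = r := by
    rw [Nat.find_eq_iff]
    exact ⟨ht', fun m hm => not_lt.2 (((hC.time_strictMono hx).monotone hm).trans ht)⟩
  rw [sol, dif_pos hex]
  have key : ∀ m, m = r → N.flow (O (Fin.ofNat k (p + m))) (hC.pos p x m) (t - hC.time p x m) =
      N.flow (O (Fin.ofNat k (p + r))) (hC.pos p x r) (t - hC.time p x r) := by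
    rintro m rfl; rfl
  apply key
  convert hfind

theorem sol_eq (r : ℕ) {t : ℝ} (ht : hC.time p x r ≤ t) (ht' : t ≤ hC.time p x (r + 1)) :
    hC.sol p x t =
      N.flow (O (Fin.ofNat k (p + r))) (hC.pos p x r) (t - hC.time p x r) := by
  rcases ht'.eq_or_lt with h | h
  · subst h
    rw [hC.sol_eq_of_lt hx (r + 1) le_rfl (hC.time_lt_succ hx _), sub_self, flow_zero,
      hC.flow_pos hx]
  · exact hC.sol_eq_of_lt hx r ht h

theorem sol_time (r : ℕ) : hC.sol p x (hC.time p x r) = hC.pos p x r := by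
  rw [hC.sol_eq hx r le_rfl (hC.time_lt_succ hx r).le, sub_self, flow_zero]

theorem sol_zero : hC.sol p x 0 = x := by
  rw [← hC.time_zero p x, hC.sol_time hx, pos_zero]

theorem sol_mem (r : ℕ) {t : ℝ} (ht : hC.time p x r ≤ t) (ht' : t < hC.time p x (r + 1)) :
    hC.sol p x t ∈ N.piece O s (Fin.ofNat k (p + r)) := by
  rw [hC.sol_eq hx r ht ht'.le]
  exact hC.flow_mem hx r ht ht'

theorem continuousOn_sol_Icc (r : ℕ) : ContinuousOn (hC.sol p x) (Set.Icc 0 (hC.time p x r)) := by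
  induction r with
  | zero =>
    rw [hC.time_zero, Set.Icc_self]
    exact continuousOn_singleton _ _
  | succ r ih =>
    rw [← Set.Icc_union_Icc_eq_Icc (hC.time_nonneg hx r) (hC.time_lt_succ hx r).le]
    refine ih.union_of_isClosed ?_ isClosed_Icc isClosed_Icc
    refine ContinuousOn.congr (f := fun t => N.flow (O (Fin.ofNat k (p + r))) (hC.pos p x r)
      (t - hC.time p x r)) ?_ fun t ht => hC.sol_eq hx r ht.1 ht.2
    exact ((continuous_flow _ _).comp (continuous_id.sub continuous_const)).continuousOn

theorem isTrajectory_sol : N.IsTrajectory O s (hC.sol p x) (hC.endTime p x) where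
  pos := by
    have := (hC.lt_endTime_iff p x 0).2 ⟨1, by
      have := hC.time_lt_succ hx 0
      rwa [hC.time_zero] at this⟩
    simpa using this
  continuousOn := by
    rintro t ⟨ht, ht'⟩
    obtain ⟨r, hr⟩ := (hC.lt_endTime_iff p x t).1 ht'
    refine (hC.continuousOn_sol_Icc hx r t ⟨ht, hr.le⟩).mono_of_mem_nhdsWithin ?_
    have h1 : Set.Iio (hC.time p x r) ∈ nhds t := Iio_mem_nhds hr
    filter_upwards [self_mem_nhdsWithin, mem_nhdsWithin_of_mem_nhds h1] with u hu hu'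
    exact ⟨hu.1, le_of_lt hu'⟩
  mem t ht ht' := by
    obtain ⟨r, hr⟩ := (hC.lt_endTime_iff p x t).1 ht'
    obtain ⟨q, hq, hq'⟩ := hC.exists_time_mem ht hr
    exact ⟨_, hC.sol_mem hx q hq hq'⟩
  deriv t ht ht' i hi := by
    obtain ⟨r, hr⟩ := (hC.lt_endTime_iff p x t).1 ht'
    obtain ⟨q, hq, hq'⟩ := hC.exists_time_mem ht hr
    obtain rfl := hC.piece_unique hi (hC.sol_mem hx q hq hq')
    have hE := hC.sol_eq hx q hq hq'.le
    have h1 := (hasDerivAt_flow (N := N) (O (Fin.ofNat k (p + q))) (hC.pos p x q) (hC.time p x q)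
      t).hasDerivWithinAt (s := Set.Ici t)
    rw [hE]
    refine h1.congr_of_eventuallyEq ?_ hE
    have h2 : Set.Iio (hC.time p x (q + 1)) ∈ nhds t := Iio_mem_nhds hq'
    filter_upwards [self_mem_nhdsWithin, mem_nhdsWithin_of_mem_nhds h2] with u hu hu'
    exact hC.sol_eq hx q (hq.trans hu) (le_of_lt hu')

end

end BinaryGlassNetwork.IsCyclicAttractor

/-! ### Uniqueness and lifetime of trajectories -/

namespace BinaryGlassNetwork

variable {n k : ℕ} [NeZero k] {N : BinaryGlassNetwork n} {O : Fin k → Fin n → Bool}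
  {s : Fin k → Fin n}

open Filter Topology Set

theorem _root_.HasDerivWithinAt.eventually_gt {φ : ℝ → ℝ} {d a : ℝ}
    (h : HasDerivWithinAt φ d (Ici a) a) (hd : 0 < d) : ∀ᶠ t in 𝓝[>] a, φ a < φ t := by
  have h1 := (hasDerivWithinAt_iff_tendsto_slope' (self_notMem_Ioi)).1 h.Ioi_of_Ici
  filter_upwards [h1.eventually (lt_mem_nhds hd), self_mem_nhdsWithin] with t ht hta
  have hta' : 0 < t - a := sub_pos.2 hta
  rw [slope_def_field, div_pos_iff_of_pos_right hta'] at ht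
  linarith

namespace IsTrajectory

variable {y : ℝ → Fin n → ℝ} {T : EReal}

/-- Coordinates off the threshold stay so by continuity. If the entrance variable is at its
threshold, its right derivative points into `O i`, since the focal point has that sign. -/
theorem eventually_mem_piece (hy : N.IsTrajectory O s y T) (hC : N.IsCyclicAttractor O s) {a : ℝ}
    (ha : 0 ≤ a) (haT : (a : EReal) < T) {i : Fin k} (hi : y a ∈ N.piece O s i) :
    ∀ᶠ t in 𝓝[≥] a, y t ∈ N.piece O s i := by
  have hd := hy.deriv a ha haT i hi
  have hdj : ∀ j, HasDerivWithinAt (fun t => boolSign (O i j) * (y t j - N.θ j))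
      (boolSign (O i j) * (N.focal (O i) j - y a j)) (Ici a) a := fun j =>
    (((hasDerivWithinAt_pi.1 hd) j).sub_const (N.θ j)).const_mul _
  have hcont : ∀ j, 0 < boolSign (O i j) * (y a j - N.θ j) →
      ∀ᶠ t in 𝓝[≥] a, 0 < boolSign (O i j) * (y t j - N.θ j) := fun j hj =>
    (hdj j).continuousWithinAt.eventually (lt_mem_nhds hj)
  have hi' := mem_piece_iff.1 hi
  have h1 : ∀ᶠ t in 𝓝[≥] a, ∀ j, j ≠ s (i - 1) → 0 < boolSign (O i j) * (y t j - N.θ j) := by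
    rw [eventually_all]
    intro j
    by_cases hj : j = s (i - 1)
    · exact Eventually.of_forall fun t h => absurd hj h
    · filter_upwards [hcont j (hi'.1 j hj)] with t ht _ using ht
  have h2 : ∀ᶠ t in 𝓝[≥] a,
      0 ≤ boolSign (O i (s (i - 1))) * (y t (s (i - 1)) - N.θ (s (i - 1))) := by
    rcases hi'.2.eq_or_lt with h0 | h0
    · have hθ : y a (s (i - 1)) = N.θ (s (i - 1)) := by
        have := boolSign_mul_mul (O i (s (i - 1))) (y a (s (i - 1)) - N.θ (s (i - 1)))
        rw [← h0, mul_zero] at this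
        linarith
      have hpos : 0 < boolSign (O i (s (i - 1))) *
          (N.focal (O i) (s (i - 1)) - y a (s (i - 1))) := by
        rw [hθ, ← hC.apply_of_ne (hC.switch_ne_prev i).symm]
        exact hC.focal_side i _
      have h3 := (hdj (s (i - 1))).eventually_gt hpos
      rw [eventually_nhdsWithin_iff] at h3 ⊢
      filter_upwards [h3] with t ht hta
      rcases (mem_Ici.1 hta).eq_or_lt with h | h
      · rw [← h]; exact hi'.2
      · have := ht h
        linarith
    · filter_upwards [hcont _ h0] with t ht using ht.le
  filter_upwards [h1, h2] with t h1 h2 using mem_piece_iff.2 ⟨h1, h2⟩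

theorem eq_flow_of_mem_piece (hy : N.IsTrajectory O s y T) {a b : ℝ}
    (ha : 0 ≤ a) (hbT : (b : EReal) < T) {i : Fin k} (hi : ∀ t ∈ Ico a b, y t ∈ N.piece O s i) :
    ∀ t ∈ Icc a b, y t = N.flow (O i) (y a) (t - a) := by
  have hlt : ∀ t, t ≤ b → (t : EReal) < T := fun t ht =>
    (EReal.coe_le_coe_iff.2 ht).trans_lt hbT
  have hcont : ContinuousOn y (Icc a b) :=
    hy.continuousOn.mono fun t ht => ⟨ha.trans ht.1, hlt t ht.2⟩
  have hexp : ∀ t : ℝ, HasDerivAt (fun t : ℝ => Real.exp (t - a)) (Real.exp (t - a)) t := fun t => by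
    simpa using ((hasDerivAt_id t).sub_const a).exp
  -- The right derivative of `e^{t - a} (y - F)` vanishes.
  have key := constant_of_has_deriv_right_zero
    (f := fun t => Real.exp (t - a) • (y t - N.focal (O i))) (a := a) (b := b)
    (((Real.continuous_exp.comp (continuous_id.sub continuous_const)).continuousOn).smul
      (hcont.sub continuousOn_const)) fun t ht => by
      have h1 := hy.deriv t (ha.trans ht.1) (hlt t ht.2.le) i (hi t ht)
      refine ((hexp t).hasDerivWithinAt.smul (h1.sub_const (N.focal (O i)))).congr_deriv ?_
      rw [← smul_add]
      simp
  intro t ht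
  have h1 := key t ht
  simp only [sub_self, Real.exp_zero, one_smul] at h1
  rw [flow, ← h1, smul_smul, ← Real.exp_add]
  simp

/-- Only the explicit flow is assumed to stay in the piece, so agreement is proved by continuous
induction: the times of agreement form a closed set, and agreement extends to the right by
`eventually_mem_piece`. -/
theorem eq_flow (hy : N.IsTrajectory O s y T) (hC : N.IsCyclicAttractor O s) {a b : ℝ}
    (ha : 0 ≤ a) (hab : a ≤ b) (hbT : (b : EReal) < T) {i : Fin k}
    (hi : ∀ t ∈ Ico a b, N.flow (O i) (y a) (t - a) ∈ N.piece O s i) :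
    y b = N.flow (O i) (y a) (b - a) := by
  have hlt : ∀ t, t ≤ b → (t : EReal) < T := fun t ht =>
    (EReal.coe_le_coe_iff.2 ht).trans_lt hbT
  have hcont : ContinuousOn y (Icc a b) :=
    hy.continuousOn.mono fun t ht => ⟨ha.trans ht.1, hlt t ht.2⟩
  have hfc : Continuous fun t => N.flow (O i) (y a) (t - a) :=
    (continuous_flow _ _).comp (continuous_id.sub continuous_const)
  have hsub : Icc a b ⊆ {t | y t = N.flow (O i) (y a) (t - a)} := by
    refine IsClosed.Icc_subset_of_forall_exists_gt ?_ ?_ ?_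
    · have : IsClosed (Icc a b ∩ (fun t => y t - N.flow (O i) (y a) (t - a)) ⁻¹' {0}) :=
        (hcont.sub hfc.continuousOn).preimage_isClosed_of_isClosed isClosed_Icc isClosed_singleton
      convert this using 1
      ext t
      simp [sub_eq_zero, and_comm]
    · simp [flow_zero]
    · rintro t ⟨ht, hta, htb⟩ c hc
      have ht' : y t = N.flow (O i) (y a) (t - a) := ht
      have hmem : y t ∈ N.piece O s i := ht' ▸ hi t ⟨hta, htb⟩
      have hev := hy.eventually_mem_piece hC (ha.trans hta) (hlt t htb.le) hmem
      obtain ⟨d, hd, hsubd⟩ := (mem_nhdsGE_iff_exists_Ico_subset).1 hev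
      have hmin : t < min (min b c) d := lt_min (lt_min htb hc) hd
      refine ⟨min (min b c) d, ?_, hmin, (min_le_left _ _).trans (min_le_right _ _)⟩
      have h1 := hy.eq_flow_of_mem_piece (a := t) (b := min (min b c) d) (i := i) (ha.trans hta)
        (hlt _ ((min_le_left _ _).trans (min_le_left _ _)))
        (fun u hu => hsubd ⟨hu.1, hu.2.trans_le (min_le_right _ _)⟩) _ (right_mem_Icc.2 hmin.le)
      change y _ = _
      rw [h1, ht', flow_flow]
      congr 1
      ring
  exact hsub (right_mem_Icc.2 hab)

/-- A trajectory is the canonical one as long as that lives. -/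
theorem eq_sol_of_le_time (hy : N.IsTrajectory O s y T) (hC : N.IsCyclicAttractor O s) {p : ℕ}
    (hx : y 0 ∈ N.piece O s (Fin.ofNat k p)) (r : ℕ) : ∀ t : ℝ, 0 ≤ t → t ≤ hC.time p (y 0) r →
      (t : EReal) < T → y t = hC.sol p (y 0) t := by
  induction r with
  | zero =>
    intro t h0 h1 _
    rw [hC.time_zero] at h1
    rw [le_antisymm h1 h0, hC.sol_zero hx]
  | succ r ih =>
    intro t h0 h1 hT
    rcases le_total t (hC.time p (y 0) r) with h | h
    · exact ih t h0 h hT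
    · have h2 := ih _ (hC.time_nonneg hx r) le_rfl ((EReal.coe_le_coe_iff.2 h).trans_lt hT)
      rw [hC.sol_time hx] at h2
      rw [hC.sol_eq hx r h h1, ← h2]
      refine hy.eq_flow hC (hC.time_nonneg hx r) h hT fun u hu => ?_
      rw [h2]
      exact hC.flow_mem hx r hu.1 (hu.2.trans_le h1)

/-- No trajectory outlives the canonical one. -/
theorem exists_lt_time (hy : N.IsTrajectory O s y T) (hC : N.IsCyclicAttractor O s) {p : ℕ}
    (hx : y 0 ∈ N.piece O s (Fin.ofNat k p)) {t : ℝ} (hT : (t : EReal) < T) :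
    ∃ r, t < hC.time p (y 0) r := by
  by_contra! hle
  have hmono := (hC.time_strictMono hx).monotone
  have hbdd : BddAbove (range (hC.time p (y 0))) := ⟨t, by rintro _ ⟨r, rfl⟩; exact hle r⟩
  have hlim := tendsto_atTop_ciSup hmono hbdd
  set L := ⨆ r, hC.time p (y 0) r
  have hLt : L ≤ t := ciSup_le hle
  have hL0 : 0 ≤ L := (hC.time_nonneg hx 0).trans (le_ciSup hbdd 0)
  have hLT : (L : EReal) < T := (EReal.coe_le_coe_iff.2 hLt).trans_lt hT
  have hyt : ∀ r, y (hC.time p (y 0) r) = hC.pos p (y 0) r := fun r => by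
    rw [hy.eq_sol_of_le_time hC hx r _ (hC.time_nonneg hx r) le_rfl
      ((EReal.coe_le_coe_iff.2 (hle r)).trans_lt hT), hC.sol_time hx]
  have hconv : Tendsto (fun r => y (hC.time p (y 0) r)) atTop (𝓝 (y L)) := by
    have hc := hy.continuousOn L ⟨hL0, hLT⟩
    refine hc.tendsto.comp (tendsto_nhdsWithin_iff.2 ⟨hlim, Eventually.of_forall fun r => ?_⟩)
    exact ⟨hC.time_nonneg hx r, (EReal.coe_le_coe_iff.2 (hle r)).trans_lt hT⟩
  -- If switchings accumulated at a time `L` before `T`, each switching variable would be at its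
  -- threshold at infinitely many of them, hence at `L`; but every piece has a switching variable
  -- strictly off its threshold.
  have hsw : ∀ i, y L (s i) = N.θ (s i) := by
    intro i
    have h1 := tendsto_pi_nhds.1 hconv (s i)
    -- The summand `p * (k - 1)` makes the index congruent to `i - p` modulo `k` without subtracting
    -- `p`.
    have hsub : Tendsto (fun q : ℕ => (q * k + (i.val + p * (k - 1))) + 1) atTop atTop := by
      refine tendsto_atTop_mono (fun q => ?_) tendsto_id
      have : q ≤ q * k := Nat.le_mul_of_pos_right q (Nat.pos_of_ne_zero (NeZero.ne k))
      simp only [id]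
      omega
    refine tendsto_nhds_unique (h1.comp hsub) (tendsto_const_nhds.congr fun q => ?_)
    simp only [Function.comp]
    have h2 := hC.pos_succ_eq hx (q * k + (i.val + p * (k - 1)))
    have h3 : Fin.ofNat k (p + (q * k + (i.val + p * (k - 1)))) = i := by
      have h4 : p + (q * k + (i.val + p * (k - 1))) = (q + p) * k + i.val := by
        obtain ⟨k', rfl⟩ := Nat.exists_eq_succ_of_ne_zero (NeZero.ne k)
        simp only [Nat.succ_eq_add_one, Nat.add_sub_cancel]
        ring
      rw [h4, Fin.ofNat_mul_add]
      simp
    rw [h3] at h2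
    rw [hyt, h2]
  obtain ⟨i, hi⟩ := hy.mem L hL0 hLT
  have := hC.piece_pos hi
  rw [hsw i] at this
  simp at this

theorem eq_sol (hy : N.IsTrajectory O s y T) (hC : N.IsCyclicAttractor O s) {p : ℕ}
    (hx : y 0 ∈ N.piece O s (Fin.ofNat k p)) {t : ℝ} (h0 : 0 ≤ t) (hT : (t : EReal) < T) :
    y t = hC.sol p (y 0) t := by
  obtain ⟨r, hr⟩ := hy.exists_lt_time hC hx hT
  exact hy.eq_sol_of_le_time hC hx r t h0 hr.le hT

theorem isMaximal_of_top (hy : N.IsTrajectory O s y ⊤) : N.IsMaximalTrajectory O s y ⊤ :=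
  ⟨hy, fun _ _ _ _ => le_top⟩

theorem shift (hy : N.IsTrajectory O s y ⊤) {c : ℝ} (hc : 0 ≤ c) :
    N.IsTrajectory O s (fun t => y (t + c)) ⊤ where
  pos := EReal.zero_lt_top
  continuousOn := by
    refine hy.continuousOn.comp (by fun_prop) fun t ht => ⟨add_nonneg ht.1 hc, EReal.coe_lt_top _⟩
  mem t ht _ := hy.mem _ (add_nonneg ht hc) (EReal.coe_lt_top _)
  deriv t ht _ i hi := by
    have h1 := hy.deriv _ (add_nonneg ht hc) (EReal.coe_lt_top _) i hi
    have h2 : HasDerivWithinAt (fun u : ℝ => u + c) 1 (Ici t) t :=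
      (hasDerivWithinAt_id t _).add_const c
    have h3 := HasDerivWithinAt.scomp t h1 h2 fun u hu => by
      simp only [mem_Ici] at hu ⊢
      linarith
    rw [one_smul] at h3
    exact h3

end IsTrajectory

/-- No trajectory outlives the canonical one, and the canonical one is itself a continuation, so
maximality gives equality. -/
theorem IsMaximalTrajectory.eq_endTime {y : ℝ → Fin n → ℝ} {T : EReal}
    (hy : N.IsMaximalTrajectory O s y T) (hC : N.IsCyclicAttractor O s) {p : ℕ}
    (hx : y 0 ∈ N.piece O s (Fin.ofNat k p)) : T = hC.endTime p (y 0) := by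
  have hle : T ≤ hC.endTime p (y 0) := by
    refine le_of_forall_lt fun c hc => ?_
    by_contra! h
    obtain ⟨t, ht, htT⟩ := EReal.lt_iff_exists_real_btwn.1 hc
    have h1 := (hC.lt_endTime_iff p (y 0) t).2 (hy.1.exists_lt_time hC hx htT)
    exact absurd h1 (not_lt.2 (h.trans ht.le))
  refine le_antisymm hle (hy.2 _ _ (hC.isTrajectory_sol hx) fun t h0 ht => ?_)
  exact (hy.1.eq_sol hC hx h0 ht).symm

end BinaryGlassNetwork

/-! ### Segments, the spine, and convergence to it -/

namespace BinaryGlassNetwork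

variable {n k : ℕ} {N : BinaryGlassNetwork n} {O : Fin k → Fin n → Bool}
  {s : Fin k → Fin n}

open Filter Topology Set

/-- The flow moves straight towards the focal point; estimates at switching points therefore pass to
all times by convexity. -/
theorem flow_mem_segment (σ : Fin n → Bool) (x : Fin n → ℝ) {t b : ℝ} (ht : 0 ≤ t) (htb : t ≤ b) :
    N.flow σ x t ∈ segment ℝ x (N.flow σ x b) := by
  rcases ht.eq_or_lt with rfl | ht
  · rw [flow_zero]; exact left_mem_segment ℝ _ _
  have hb : Real.exp (-b) < 1 := by simpa using ht.trans_le htb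
  have h1 : Real.exp (-t) ≤ 1 := by simpa using ht.le
  have h2 : Real.exp (-b) ≤ Real.exp (-t) := by simpa using htb
  have h3 : 1 - Real.exp (-b) ≠ 0 := by linarith
  refine ⟨(Real.exp (-t) - Real.exp (-b)) / (1 - Real.exp (-b)),
    (1 - Real.exp (-t)) / (1 - Real.exp (-b)), div_nonneg (by linarith) (by linarith),
    div_nonneg (by linarith) (by linarith), by field_simp; ring, ?_⟩
  ext j
  simp only [flow, Pi.add_apply, Pi.smul_apply, Pi.sub_apply, smul_eq_mul]
  field_simp
  ring

theorem exists_flow_eq_of_mem_segment (σ : Fin n → Bool) (x : Fin n → ℝ) {b : ℝ} (hb : 0 ≤ b)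
    {w : Fin n → ℝ} (hw : w ∈ segment ℝ x (N.flow σ x b)) : ∃ t ∈ Icc 0 b, N.flow σ x t = w := by
  obtain ⟨c, d, hc, hd, hcd, rfl⟩ := hw
  have hb1 : Real.exp (-b) ≤ 1 := by simpa using hb
  have hb0 : 0 < Real.exp (-b) := Real.exp_pos _
  have hle : Real.exp (-b) ≤ c + d * Real.exp (-b) := by
    have : c * Real.exp (-b) ≤ c * 1 := mul_le_mul_of_nonneg_left hb1 hc
    have h2 : Real.exp (-b) = (c + d) * Real.exp (-b) := by rw [hcd, one_mul]
    linarith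
  have hpos : 0 < c + d * Real.exp (-b) := hb0.trans_le hle
  refine ⟨-Real.log (c + d * Real.exp (-b)), ⟨?_, ?_⟩, ?_⟩
  · rw [neg_nonneg]
    refine Real.log_nonpos hpos.le ?_
    have : d * Real.exp (-b) ≤ d * 1 := mul_le_mul_of_nonneg_left hb1 hd
    linarith
  · have := Real.log_le_log hb0 hle
    rw [Real.log_exp] at this
    linarith
  · ext j
    simp only [flow, Pi.add_apply, Pi.smul_apply, Pi.sub_apply, smul_eq_mul, neg_neg,
      Real.exp_log hpos]
    linear_combination (-N.focal σ j) * hcd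

theorem eq_threshold_of_mem_spine {x : Fin n → ℝ} (hx : x ∈ N.spine O s) (i : Fin k) :
    x (s i) = N.θ (s i) := by
  have h1 : N.wall (O i) (s i) ⊆ {x | x (s i) = N.θ (s i)} := fun x hx => hx.1
  exact closure_minimal h1 (isClosed_eq (continuous_apply _) continuous_const)
    (mem_iInter.1 hx i)

theorem mem_spine {x : Fin n → ℝ} (h : ∀ i, x (s i) = N.θ (s i))
    (h' : ∀ i j, 0 ≤ boolSign (O i j) * (x j - N.θ j)) : x ∈ N.spine O s := by
  refine mem_iInter.2 fun i => ?_
  -- Pushing every coordinate other than `s i` by `δ` into the orthant `O i` gives points of the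
  -- open wall.
  let z : ℝ → Fin n → ℝ := fun δ j => if j = s i then N.θ j else x j + δ * boolSign (O i j)
  have hz : Tendsto z (𝓝[>] 0) (𝓝 x) := by
    refine tendsto_pi_nhds.2 fun j => ?_
    by_cases hj : j = s i
    · subst hj
      simp only [z, if_true, h i]
      exact tendsto_const_nhds
    · simp only [z, if_neg hj]
      have : Tendsto (fun δ : ℝ => x j + δ * boolSign (O i j)) (𝓝 0)
          (𝓝 (x j + 0 * boolSign (O i j))) := by
        apply Continuous.tendsto; fun_prop
      rw [zero_mul, add_zero] at this
      exact this.mono_left nhdsWithin_le_nhds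
  refine mem_closure_of_tendsto hz ?_
  filter_upwards [self_mem_nhdsWithin] with δ hδ
  refine ⟨by simp [z], fun j hj => ?_⟩
  rw [onSide_iff]
  simp only [z, if_neg hj]
  have h1 := h' i j
  have h2 := boolSign_mul_self (O i j)
  have hδ' : 0 < δ := hδ
  have h3 : boolSign (O i j) * (x j + δ * boolSign (O i j) - N.θ j) =
      boolSign (O i j) * (x j - N.θ j) + δ := by linear_combination δ * h2
  rw [h3]
  linarith

theorem spine_nonempty : (N.spine O s).Nonempty :=
  ⟨N.θ, mem_spine (fun _ => rfl) fun i j => by simp⟩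

theorem isClosed_spine : IsClosed (N.spine O s) := isClosed_iInter fun _ => isClosed_closure

variable [NeZero k]

theorem not_mem_spine_of_mem_piece (hC : N.IsCyclicAttractor O s) {i : Fin k} {x : Fin n → ℝ}
    (hx : x ∈ N.piece O s i) : x ∉ N.spine O s := fun h => by
  have := hC.piece_pos hx
  rw [eq_threshold_of_mem_spine h i] at this
  simp at this

theorem periodic_nat {y : ℝ → Fin n → ℝ} {P : ℝ} (hP : 0 < P)
    (h : ∀ t : ℝ, 0 ≤ t → y (t + P) = y t) (q : ℕ) {t : ℝ} (ht : 0 ≤ t) :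
    y (t + q * P) = y t := by
  induction q with
  | zero => simp
  | succ q ih =>
    rw [show t + ((q + 1 : ℕ) : ℝ) * P = (t + q * P) + P by push_cast; ring, h _ (by positivity), ih]

/-- A periodic trajectory keeps returning to its starting point, which lies off the closed spine. -/
theorem not_allConvergeToSpine_of_periodic (hC : N.IsCyclicAttractor O s) {γ : Set (Fin n → ℝ)}
    (hγ : N.IsPeriodicOrbit O s γ) : ¬ N.AllConvergeToSpine O s := by
  obtain ⟨y, P, hy, hP, hper, -⟩ := hγ
  intro hall
  obtain ⟨i, hi⟩ := hy.mem 0 le_rfl hy.pos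
  apply not_mem_spine_of_mem_piece hC hi
  rw [isClosed_spine.mem_iff_infDist_zero spine_nonempty]
  refine le_antisymm (le_of_forall_pos_le_add fun ε hε => ?_) Metric.infDist_nonneg
  obtain ⟨r, -, -, h⟩ := hall y ⊤ hy.isMaximal_of_top ε hε
  obtain ⟨q, hq⟩ := exists_nat_gt (r / P)
  rw [div_lt_iff₀ hP] at hq
  have := h (0 + q * P) (by linarith) (EReal.coe_lt_top _)
  rw [periodic_nat hP hper q le_rfl] at this
  linarith

namespace IsCyclicAttractor

variable (hC : N.IsCyclicAttractor O s)

include hC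

theorem apply_eq_of_not_switching {j : Fin n} (hj : ∀ i, s i ≠ j) (i i' : Fin k) :
    O i j = O i' j := by
  have h : ∀ r : ℕ, O (Fin.ofNat k r) j = O (Fin.ofNat k 0) j := by
    intro r
    induction r with
    | zero => rfl
    | succ r ih => rw [Fin.ofNat_succ', hC.apply_of_ne (hj _).symm, ih]
  have h1 := h i.val
  have h2 := h i'.val
  simp only [Fin.ofNat_eq_cast, Fin.cast_val_eq_self] at h1 h2
  rw [h1, h2]

theorem abs_pos_sub (p : ℕ) (x : Fin n → ℝ) (r : ℕ) (j : Fin n) :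
    |hC.pos p x r j - N.θ j| = |hC.state p x r (some j) / hC.state p x r none| := by
  rw [pos, point, add_sub_cancel_left, abs_boolSign_mul]

theorem state_add {p : ℕ} (hp : p < k) (x : Fin n → ℝ) (r : ℕ) :
    hC.state p x (k - p + r) = hC.system.cyc 0 r (hC.state p x (k - p)) := by
  rw [state, CyclicSystem.cyc_add, show p + (k - p) = 0 + hC.system.k by
    change p + (k - p) = 0 + k; omega, CyclicSystem.cyc_add_period]
  rfl

theorem state_onWall_last {p : ℕ} (hp : p < k) {x : Fin n → ℝ}
    (hx : x ∈ N.piece O s (Fin.ofNat k p)) :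
    hC.system.OnWall (hC.system.k - 1) (hC.state p x (k - p)) := by
  have := hC.state_onWall hx (k - p - 1)
  rwa [show k - p - 1 + 1 = k - p by omega, show p + (k - p - 1) = hC.system.k - 1 by
    change _ = k - 1; omega] at this

theorem sol_mem_segment {p : ℕ} {x : Fin n → ℝ} (hx : x ∈ N.piece O s (Fin.ofNat k p)) {r : ℕ}
    {t : ℝ} (ht : hC.time p x r ≤ t) (ht' : t ≤ hC.time p x (r + 1)) :
    hC.sol p x t ∈ segment ℝ (hC.pos p x r) (hC.pos p x (r + 1)) := by
  rw [hC.sol_eq hx r ht ht', ← hC.flow_pos hx r]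
  exact flow_mem_segment _ _ (by linarith) (by linarith)

theorem exists_segment {p : ℕ} {x : Fin n → ℝ} (hx : x ∈ N.piece O s (Fin.ofNat k p)) {R : ℕ}
    {t : ℝ} (ht : hC.time p x R ≤ t) {r' : ℕ} (ht' : t < hC.time p x r') :
    ∃ r, R ≤ r ∧ hC.time p x r ≤ t ∧ t < hC.time p x (r + 1) ∧
      hC.sol p x t ∈ segment ℝ (hC.pos p x r) (hC.pos p x (r + 1)) := by
  obtain ⟨r, hr, hr'⟩ := hC.exists_time_mem ((hC.time_nonneg hx R).trans ht) ht'
  refine ⟨r, ?_, hr, hr', hC.sol_mem_segment hx hr hr'.le⟩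
  by_contra! h
  have := (hC.time_strictMono hx).monotone (Nat.succ_le_of_lt h)
  linarith

theorem allConvergeToSpine_of_isPerron {l : ℝ} {u : Option (Fin n) → ℝ}
    (h : hC.system.IsPerron l u) (hl : l ≤ 1) : N.AllConvergeToSpine O s := by
  intro y T hy ε hε
  obtain ⟨i, hi⟩ := hy.1.mem 0 le_rfl hy.1.pos
  obtain ⟨p, hp, rfl⟩ : ∃ p < k, i = Fin.ofNat k p := ⟨i.val, i.isLt, by simp⟩
  have hT := hy.eq_endTime hC hi
  obtain ⟨R, hR⟩ := h.exists_ratio_lt hl (hC.state_onWall_last hp hi) hC.none_not_switching hε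
  have hsmall : ∀ r, k - p + R ≤ r → ∀ i, |hC.pos p (y 0) r (s i) - N.θ (s i)| < ε := by
    intro r hr i
    obtain ⟨r', rfl⟩ := Nat.exists_eq_add_of_le (show k - p ≤ r by omega)
    have hnn : 0 ≤ hC.state p (y 0) (k - p + r') :=
      CyclicSystem.cyc_nonneg hC.system p (k - p + r') (hC.lift_nonneg hi)
    rw [hC.abs_pos_sub, abs_of_nonneg (div_nonneg (hnn _) (hnn _)), hC.state_add hp]
    exact hR r' (by omega) _ ((hC.some_switching_iff _).2 ⟨i, rfl⟩)
  refine ⟨hC.time p (y 0) (k - p + R), hC.time_nonneg hi _, ?_, fun t ht htT => ?_⟩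
  · rw [hT, hC.lt_endTime_iff]
    exact ⟨_, hC.time_lt_succ hi _⟩
  have ht0 : 0 ≤ t := (hC.time_nonneg hi _).trans ht
  obtain ⟨r', hr'⟩ := hy.1.exists_lt_time hC hi htT
  obtain ⟨r, hRr, -, -, hseg⟩ := hC.exists_segment hi ht hr'
  rw [← hy.1.eq_sol hC hi ht0 htT] at hseg
  have hyt : ∀ i, |y t (s i) - N.θ (s i)| < ε := by
    intro i
    have hconv : Convex ℝ ((LinearMap.proj (R := ℝ) (φ := fun _ : Fin n => ℝ) (s i)) ⁻¹'
        Metric.ball (N.θ (s i)) ε) := (convex_ball _ _).linear_preimage _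
    have := hconv.segment_subset (x := hC.pos p (y 0) r) (y := hC.pos p (y 0) (r + 1))
      (by simpa [Real.dist_eq] using hsmall r hRr i)
      (by simpa [Real.dist_eq] using hsmall (r + 1) (by omega) i) hseg
    simpa [Real.dist_eq] using this
  obtain ⟨i', hi'⟩ := hy.1.mem t ht0 htT
  classical
  -- Only the switching coordinates are reset. The others keep the same side in all regions, so `z`
  -- lies in every closed orthant of the cycle.
  let z : Fin n → ℝ := fun j => if ∃ i, s i = j then N.θ j else y t j
  have hz : z ∈ N.spine O s := by
    refine mem_spine (fun i => by simp [z]) fun i j => ?_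
    by_cases hj : ∃ i, s i = j
    · simp [z, hj]
    · simp only [z, if_neg hj]
      rw [hC.apply_eq_of_not_switching (not_exists.1 hj) i i']
      exact hC.piece_nonneg hi' j
  refine (Metric.infDist_le_dist_of_mem hz).trans_lt ((dist_pi_lt_iff hε).2 fun j => ?_)
  by_cases hj : ∃ i, s i = j
  · obtain ⟨i, rfl⟩ := hj
    simpa [z, Real.dist_eq] using hyt i
  · simp [z, hj, hε]

end IsCyclicAttractor

end BinaryGlassNetwork

/-! ### Tools for stability -/

section

open Filter Topology Set

/-- The closed set where `h ≥ ε` is disjoint from the compact set, hence at positive distance. The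
form "for all small `δ`" lets finitely many such conditions share one `δ`. -/
theorem IsCompact.eventually_lt_of_infDist_lt {α : Type*} [PseudoMetricSpace α] {Γ K : Set α}
    (hΓ : IsCompact Γ) (hne : Γ.Nonempty) (hK : IsClosed K) {h : α → ℝ} (hc : ContinuousOn h K)
    (h0 : ∀ x ∈ Γ, x ∈ K → h x = 0) {ε : ℝ} (hε : 0 < ε) :
    ∀ᶠ δ in 𝓝[>] (0 : ℝ), ∀ x ∈ K, Metric.infDist x Γ < δ → h x < ε := by
  have hcl : IsClosed (K ∩ h ⁻¹' Ici ε) := hc.preimage_isClosed_of_isClosed hK isClosed_Ici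
  have hdisj : Disjoint Γ (K ∩ h ⁻¹' Ici ε) := by
    rw [Set.disjoint_left]
    rintro x hx ⟨hxK, hxε⟩
    have : ε ≤ h x := hxε
    rw [h0 x hx hxK] at this
    linarith
  obtain ⟨δ, hδ, hd⟩ := hdisj.exists_thickenings hΓ hcl
  filter_upwards [Ioo_mem_nhdsGT hδ] with δ' hδ' x hxK hx
  by_contra! hle
  exact Set.disjoint_left.1 hd
    (Metric.mem_thickening_iff.2 ((Metric.infDist_lt_iff hne).1 (hx.trans hδ'.2)))
    (Metric.self_subset_thickening hδ _ ⟨hxK, hle⟩)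

theorem infDist_lt_of_segment {E : Type*} [NormedAddCommGroup E] [NormedSpace ℝ E] {γ : Set E}
    {a b p q w : E} {ε : ℝ} (ha : dist a p < ε) (hb : dist b q < ε) (hw : w ∈ segment ℝ a b)
    (hγ : segment ℝ p q ⊆ γ) : Metric.infDist w γ < ε := by
  obtain ⟨c, d, hc, hd, hcd, rfl⟩ := hw
  refine (Metric.infDist_le_dist_of_mem (hγ ⟨c, d, hc, hd, hcd, rfl⟩)).trans_lt ?_
  have h := (convex_ball (0 : E) ε) (x := a - p) (by simpa [dist_eq_norm] using ha) (y := b - q)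
    (by simpa [dist_eq_norm] using hb) hc hd hcd
  rw [mem_ball_zero_iff] at h
  have heq : c • a + d • b - (c • p + d • q) = c • (a - p) + d • (b - q) := by
    rw [smul_sub, smul_sub]
    abel
  rwa [dist_eq_norm, heq]

end

namespace CyclicSystem.IsPositiveEigenvector

variable {ι : Type*} [DecidableEq ι] {C : CyclicSystem ι} {l : ℝ} {v : ι → ℝ}
  (h : C.IsPositiveEigenvector l v)

include h

theorem onWall_cyc (p : ℕ) : C.OnWall p (C.cyc 0 (p + 1) v) := by
  have h1 := h.onWall.cyc (p + 1)
  rw [Nat.sub_add_cancel C.k_pos, ← Nat.zero_add C.k, cyc_add_period] at h1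
  have h2 : C.m (0 + C.k - 1 + (p + 1)) = C.m p := by
    rw [← C.m_add p]
    congr 1
    have := C.k_pos
    omega
  unfold OnWall at h1 ⊢
  rwa [h2] at h1

variable [Fintype ι]

/-- States on a wall that are projectively close to the positive eigenvector remain so. -/
theorem exists_forall_abs_ratio_sub_lt {z : ι} (hz : z ∉ C.switching) {ε : ℝ} (hε : 0 < ε)
    (p : ℕ) : ∃ δ : ℝ, 0 < δ ∧ ∀ X : ι → ℝ, C.OnWall p X →
      (∀ j, |X j / X z - C.cyc 0 (p + 1) v j / C.cyc 0 (p + 1) v z| < δ) →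
      ∀ r j, |C.cyc (p + 1) r X j / C.cyc (p + 1) r X z -
        C.cyc 0 (p + 1 + r) v j / C.cyc 0 (p + 1 + r) v z| < ε := by
  obtain ⟨K, hK, hKr⟩ := h.exists_ratio_le z
  have hV := h.onWall_cyc p
  set V := C.cyc 0 (p + 1) v with hVdef
  have hVz : 0 < V z := h.cyc_pos hz _
  obtain ⟨j0, hj0, hmin⟩ := Finset.exists_min_image (Finset.univ.filter fun j => j ≠ C.m p)
    (fun j => V j / V z) ⟨C.m (p + 1), by simp [C.m_succ_ne]⟩
  simp only [Finset.mem_filter, Finset.mem_univ, true_and] at hj0 hmin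
  set c := V j0 / V z
  have hc : 0 < c := div_pos (hV.2 _ hj0) hVz
  -- For `η ≤ 1/2` the bounds `(1 - η) t V ≤ X ≤ (1 + η) t V` give a relative error of at most `4
  -- η`, so the absolute error is at most `4 η K ≤ ε / 2`.
  set η := min (1 / 2) (ε / (8 * K)) with hη
  have hη0 : 0 < η := lt_min (by norm_num) (by positivity)
  have hη1 : η ≤ 1 / 2 := min_le_left _ _
  have hη2 : η * (8 * K) ≤ ε := (le_div_iff₀ (by positivity)).1 (min_le_right _ _)
  -- Since `c` is the least quotient off the wall coordinate, an absolute error `η c` is a relative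
  -- error `η`. Monotone steps preserve the resulting order interval, hence uniformity in `r`.
  refine ⟨η * c, by positivity, fun X hX hclose r j => ?_⟩
  have hXz : 0 < X z := hX.2 z fun e => hz ⟨_, e.symm⟩
  have hratio : ∀ j, (1 - η) * (V j / V z) ≤ X j / X z ∧ X j / X z ≤ (1 + η) * (V j / V z) := by
    intro j
    by_cases hj : j = C.m p
    · subst hj; rw [hX.1, hV.1]; simp
    · have h1 := abs_lt.1 (hclose j)
      have h2 : η * c ≤ η * (V j / V z) := mul_le_mul_of_nonneg_left (hmin j hj) hη0.le
      constructor <;> linarith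
  set t := X z / V z with ht
  have ht0 : 0 < t := div_pos hXz hVz
  have hconv : ∀ e j, (e * t) * V j = e * (V j / V z) * X z := fun e j => by
    rw [ht]; field_simp
  have hlo : ((1 - η) * t) • V ≤ X := fun j => by
    change (1 - η) * t * V j ≤ X j
    rw [hconv, ← le_div_iff₀ hXz]
    exact (hratio j).1
  have hup : X ≤ ((1 + η) * t) • V := fun j => by
    change X j ≤ (1 + η) * t * V j
    rw [hconv, ← div_le_iff₀ hXz]
    exact (hratio j).2
  have h5 := smul_le_cyc (C := C) hlo (p + 1) r
  have h6 := cyc_le_smul (C := C) hup (p + 1) r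
  have hcyc : C.cyc (p + 1) r V = C.cyc 0 (p + 1 + r) v := by
    rw [C.cyc_add, zero_add]
  rw [hcyc] at h5 h6
  have hpos : 0 < (1 - η) * t := mul_pos (by linarith) ht0
  have hv := C.cyc_nonneg 0 (p + 1 + r) h.onWall.nonneg
  have h7 := abs_ratio_sub_le hpos hv h5 h6 (h.cyc_pos hz _) j
  refine h7.trans_lt ?_
  have h8 : (1 + η) * t / ((1 - η) * t) - 1 ≤ 4 * η := by
    rw [mul_div_mul_right _ _ ht0.ne', sub_le_iff_le_add, div_le_iff₀ (by linarith)]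
    nlinarith
  have h9 : 0 ≤ C.cyc 0 (p + 1 + r) v j / C.cyc 0 (p + 1 + r) v z :=
    div_nonneg (hv _) (hv _)
  calc _ ≤ 4 * η * (C.cyc 0 (p + 1 + r) v j / C.cyc 0 (p + 1 + r) v z) :=
        mul_le_mul_of_nonneg_right h8 h9
    _ ≤ 4 * η * K := mul_le_mul_of_nonneg_left (hKr _ _) (by positivity)
    _ < ε := by linarith

end CyclicSystem.IsPositiveEigenvector

namespace BinaryGlassNetwork.IsCyclicAttractor

variable {n k : ℕ} [NeZero k] {N : BinaryGlassNetwork n} {O : Fin k → Fin n → Bool}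
  {s : Fin k → Fin n}

theorem exitFactor_flow (hC : N.IsCyclicAttractor O s) (i : Fin k) (x : Fin n → ℝ) (t : ℝ) :
    N.exitFactor O s i (N.flow (O i) x t) = Real.exp (-t) * N.exitFactor O s i x := by
  have h1 := (hC.focal_side i (s i)).ne'
  simp only [exitFactor, flow_sub_threshold]
  rw [hC.apply_self, boolSign_not] at h1 ⊢
  have h2 : boolSign (O i (s i)) ≠ 0 := by intro h; simp [h] at h1
  have h3 : N.focal (O i) (s i) - N.θ (s i) ≠ 0 := by intro h; simp [h] at h1
  field_simp
  ring

theorem pos_one_of_flow (hC : N.IsCyclicAttractor O s) {p : ℕ} {q : Fin n → ℝ}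
    (hq : q ∈ N.piece O s (Fin.ofNat k p)) {t : ℝ}
    (ht : Real.exp t = N.exitFactor O s (Fin.ofNat k p) q) :
    hC.pos p q 1 = N.flow (O (Fin.ofNat k p)) q t := by
  have h1 := hC.flow_pos hq 0
  have h2 := hC.exp_time_sub hq 0
  rw [hC.pos_zero] at h1 h2
  rw [add_zero, ← ht] at h2
  rw [add_zero, Real.exp_injective h2] at h1
  exact h1.symm

/-- A point on the exit wall is not in the piece, but the formula for the first exit extends to it
with zero elapsed time. Closed orthants contain such points. -/
theorem pos_one_of_wall (hC : N.IsCyclicAttractor O s) {p : ℕ} {q : Fin n → ℝ}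
    (hq : q (s (Fin.ofNat k p)) = N.θ (s (Fin.ofNat k p))) : hC.pos p q 1 = q := by
  have hm : N.lift (O (Fin.ofNat k p)) q (hC.system.m p) = 0 := by
    change N.lift (O (Fin.ofNat k p)) q (some _) = 0
    rw [lift_some, hq]
    simp
  have hst : hC.state p q 1 = N.lift (O (Fin.ofNat k p)) q := by
    change hC.system.step p _ = _
    ext j
    rw [CyclicSystem.step_apply]
    split_ifs with hj
    · rw [hj, hm]
    · rw [hm, mul_zero, add_zero]
  ext j
  rw [pos, hst, point, lift_none, div_one, lift_some, Fin.ofNat_succ']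
  by_cases hj : j = s (Fin.ofNat k p)
  · rw [hj, hq]; simp
  · rw [hC.apply_of_ne hj, boolSign_mul_mul]
    ring

theorem continuousOn_pos_one (hC : N.IsCyclicAttractor O s) (p : ℕ) :
    ContinuousOn (fun x => hC.pos p x 1)
      {x | ∀ j, 0 ≤ boolSign (O (Fin.ofNat k p) j) * (x j - N.θ j)} := by
  have hlift : Continuous (N.lift (O (Fin.ofNat k p))) := by
    refine continuous_pi fun j => ?_
    cases j with
    | none => exact continuous_const
    | some j => simp only [lift_some]; fun_prop
  have hst : ∀ j, Continuous fun x => hC.state p x 1 j := fun j =>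
    (continuous_apply j).comp
      ((LinearMap.continuous_of_finiteDimensional (hC.system.step p)).comp hlift)
  refine continuousOn_pi.2 fun j => ?_
  simp only [pos, point]
  refine continuousOn_const.add (continuousOn_const.mul
    ((hst _).continuousOn.div (hst _).continuousOn fun x hx => ?_))
  have hnn : 0 ≤ N.lift (O (Fin.ofNat k p)) x := by
    intro j
    cases j with
    | none => exact zero_le_one
    | some j => exact hx j
  have := CyclicSystem.cyc_le_cyc_of_not_switching hC.none_not_switching hnn p 1
  exact (zero_lt_one.trans_le this).ne'

end BinaryGlassNetwork.IsCyclicAttractor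

/-! ### The periodic orbit: existence, attraction, stability, uniqueness -/

namespace BinaryGlassNetwork.IsCyclicAttractor

open Filter Topology Set

variable {n k : ℕ} [NeZero k] {N : BinaryGlassNetwork n} {O : Fin k → Fin n → Bool}
  {s : Fin k → Fin n} (hC : N.IsCyclicAttractor O s)

/-- The point on the section `W_{k-1}` with absolute coordinates `v`. -/
noncomputable def sectionPoint (_ : N.IsCyclicAttractor O s) (v : Option (Fin n) → ℝ) :
    Fin n → ℝ :=
  N.point (O (Fin.ofNat k 0)) v

/-- The orbit of the canonical trajectory through a point of the section. -/
noncomputable def orbit (v : Option (Fin n) → ℝ) : Set (Fin n → ℝ) :=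
  hC.sol 0 (hC.sectionPoint v) '' Ici 0

section

variable {l : ℝ} {v : Option (Fin n) → ℝ} (h : hC.system.IsPositiveEigenvector l v)

include h

theorem exists_lt_time {p : ℕ} {x : Fin n → ℝ} (hx : x ∈ N.piece O s (Fin.ofNat k p)) (hp : p < k)
    (t : ℝ) : ∃ r, t < hC.time p x r := by
  obtain ⟨r, hr⟩ := h.exists_lt_cyc (hC.state_onWall_last hp hx) hC.none_not_switching (Real.exp t)
  rw [← hC.state_add hp, ← hC.exp_time hx] at hr
  exact ⟨_, Real.exp_lt_exp.1 hr⟩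

theorem endTime_eq_top {p : ℕ} {x : Fin n → ℝ} (hx : x ∈ N.piece O s (Fin.ofNat k p))
    (hp : p < k) : hC.endTime p x = ⊤ :=
  (EReal.eq_top_iff_forall_lt _).2 fun t =>
    (hC.lt_endTime_iff p x t).2 (hC.exists_lt_time h hx hp t)

theorem isTrajectory_sol_top {p : ℕ} {x : Fin n → ℝ} (hx : x ∈ N.piece O s (Fin.ofNat k p))
    (hp : p < k) : N.IsTrajectory O s (hC.sol p x) ⊤ := by
  rw [← hC.endTime_eq_top h hx hp]
  exact hC.isTrajectory_sol hx

theorem sectionPoint_mem : hC.sectionPoint v ∈ N.piece O s (Fin.ofNat k 0) := by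
  have h1 := hC.point_mem_piece h.onWall
  rw [Nat.sub_add_cancel hC.system.k_pos] at h1
  have h2 : Fin.ofNat k hC.system.k = Fin.ofNat k 0 := by
    have := Fin.ofNat_add_self k 0
    rwa [zero_add] at this
  rwa [h2] at h1

variable (hv : v none = 1)

include hv

omit h in
theorem state_sectionPoint (r : ℕ) :
    hC.state 0 (hC.sectionPoint v) r = hC.system.cyc 0 r v := by
  have := N.smul_lift_point (O (Fin.ofNat k 0)) (X := v) (by rw [hv]; exact one_ne_zero)
  rw [hv, one_smul] at this
  rw [state, sectionPoint, this]

theorem pos_sectionPoint_mul_add (q r : ℕ) :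
    hC.pos 0 (hC.sectionPoint v) (q * k + r) = hC.pos 0 (hC.sectionPoint v) r := by
  have h1 := h.cyc_mul_add q r
  change hC.system.cyc 0 (q * k + r) v = _ at h1
  have hl : l ^ q ≠ 0 := pow_ne_zero _ (by linarith [h.one_lt])
  rw [pos, pos, hC.state_sectionPoint hv, hC.state_sectionPoint hv, h1, point_smul _ _ hl,
    zero_add, Fin.ofNat_mul_add, zero_add]

theorem pos_sectionPoint_congr {a b : ℕ} (hab : Fin.ofNat k a = Fin.ofNat k b) :
    hC.pos 0 (hC.sectionPoint v) a = hC.pos 0 (hC.sectionPoint v) b := by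
  have h1 : a % k = b % k := by simpa [Fin.ofNat, Fin.ext_iff] using hab
  rw [← Nat.div_add_mod' a k, ← Nat.div_add_mod' b k, hC.pos_sectionPoint_mul_add h hv,
    hC.pos_sectionPoint_mul_add h hv, h1]

theorem pos_sectionPoint_period : hC.pos 0 (hC.sectionPoint v) k = hC.sectionPoint v := by
  have := hC.pos_sectionPoint_mul_add h hv 1 0
  rwa [one_mul, add_zero, pos_zero] at this

omit hv in
theorem period_pos : 0 < hC.time 0 (hC.sectionPoint v) k := by
  have h1 := hC.time_strictMono (hC.sectionPoint_mem h) (Nat.pos_of_ne_zero (NeZero.ne k))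
  rwa [hC.time_zero] at h1

/-- The trajectory delayed by one turn starts at the same point, because the eigenvector is
projectively fixed; forward uniqueness does the rest. -/
theorem sol_add_period {t : ℝ} (ht : 0 ≤ t) :
    hC.sol 0 (hC.sectionPoint v) (t + hC.time 0 (hC.sectionPoint v) k) =
      hC.sol 0 (hC.sectionPoint v) t := by
  have hx := hC.sectionPoint_mem h
  have htr := (hC.isTrajectory_sol_top h hx (Nat.pos_of_ne_zero (NeZero.ne k))).shift
    (hC.period_pos h).le
  have h0 : hC.sol 0 (hC.sectionPoint v) (0 + hC.time 0 (hC.sectionPoint v) k) =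
      hC.sectionPoint v := by
    rw [zero_add, hC.sol_time hx, hC.pos_sectionPoint_period h hv]
  have h1 := htr.eq_sol hC (p := 0) (by simp only [h0]; exact hx) ht (EReal.coe_lt_top _)
  simp only [h0] at h1
  exact h1

theorem isPeriodicOrbit_orbit : N.IsPeriodicOrbit O s (hC.orbit v) :=
  ⟨hC.sol 0 (hC.sectionPoint v), hC.time 0 (hC.sectionPoint v) k,
    hC.isTrajectory_sol_top h (hC.sectionPoint_mem h) (Nat.pos_of_ne_zero (NeZero.ne k)),
    hC.period_pos h, fun _ ht => hC.sol_add_period h hv ht, rfl⟩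

theorem isCompact_orbit : IsCompact (hC.orbit v) := by
  have hx := hC.sectionPoint_mem h
  have hP := hC.period_pos h
  have heq : hC.orbit v =
      hC.sol 0 (hC.sectionPoint v) '' Icc 0 (hC.time 0 (hC.sectionPoint v) k) := by
    apply Subset.antisymm
    · rintro _ ⟨t, ht, rfl⟩
      have ht' : 0 ≤ t := ht
      set P := hC.time 0 (hC.sectionPoint v) k
      have h1 : (⌊t / P⌋₊ : ℝ) * P ≤ t := (le_div_iff₀ hP).1 (Nat.floor_le (by positivity))
      have h2 : t < (⌊t / P⌋₊ + 1 : ℝ) * P := (div_lt_iff₀ hP).1 (Nat.lt_floor_add_one _)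
      refine ⟨t - ⌊t / P⌋₊ * P, ⟨by linarith, by linarith⟩, ?_⟩
      have := periodic_nat hP (fun t ht => hC.sol_add_period h hv ht) ⌊t / P⌋₊
        (t := t - ⌊t / P⌋₊ * P) (by linarith)
      rw [sub_add_cancel] at this
      exact this.symm
    · exact image_mono fun t ht => ht.1
  rw [heq]
  exact isCompact_Icc.image_of_continuousOn (hC.continuousOn_sol_Icc hx k)

omit hv in
theorem pos_mem_orbit (r : ℕ) : hC.pos 0 (hC.sectionPoint v) r ∈ hC.orbit v :=
  ⟨_, hC.time_nonneg (hC.sectionPoint_mem h) r, hC.sol_time (hC.sectionPoint_mem h) r⟩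

omit hv in
theorem segment_subset_orbit (r : ℕ) : segment ℝ (hC.pos 0 (hC.sectionPoint v) r)
    (hC.pos 0 (hC.sectionPoint v) (r + 1)) ⊆ hC.orbit v := by
  have hx := hC.sectionPoint_mem h
  intro w hw
  rw [← hC.flow_pos hx r] at hw
  obtain ⟨t, ht, rfl⟩ := exists_flow_eq_of_mem_segment _ _
    (sub_nonneg.2 (hC.time_lt_succ hx r).le) hw
  refine ⟨hC.time 0 (hC.sectionPoint v) r + t, add_nonneg (hC.time_nonneg hx r) ht.1, ?_⟩
  rw [hC.sol_eq hx r (by linarith [ht.1]) (by linarith [ht.2]), add_sub_cancel_left]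

omit h in
theorem dist_pos_lt {p : ℕ} (x : Fin n → ℝ) {r : ℕ} {ε : ℝ} (hε : 0 < ε)
    (hr : ∀ j, |hC.state p x r j / hC.state p x r none -
      hC.system.cyc 0 (p + r) v j / hC.system.cyc 0 (p + r) v none| < ε) :
    dist (hC.pos p x r) (hC.pos 0 (hC.sectionPoint v) (p + r)) < ε := by
  rw [dist_pi_lt_iff hε]
  intro j
  rw [pos, pos, hC.state_sectionPoint hv, zero_add, point, point, dist_add_left, Real.dist_eq,
    ← mul_sub, abs_boolSign_mul]
  exact hr (some j)

theorem abs_ratio_sub_lt_of_dist {p : ℕ} (x : Fin n → ℝ) (r : ℕ)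
    {ε : ℝ} (hε : 0 < ε) (hd : dist (hC.pos p x r) (hC.pos 0 (hC.sectionPoint v) (p + r)) < ε)
    (hnone : hC.state p x r none ≠ 0) (j : Option (Fin n)) :
    |hC.state p x r j / hC.state p x r none -
      hC.system.cyc 0 (p + r) v j / hC.system.cyc 0 (p + r) v none| < ε := by
  cases j with
  | none =>
    rw [div_self hnone, div_self (h.cyc_pos hC.none_not_switching _).ne']
    simpa using hε
  | some j =>
    have := (dist_pi_lt_iff hε).1 hd j
    rwa [pos, pos, hC.state_sectionPoint hv, zero_add, point, point, dist_add_left, Real.dist_eq,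
      ← mul_sub, abs_boolSign_mul] at this

/-- Every maximal trajectory exists for all times and converges to the periodic orbit. -/
theorem tendsto_infDist_orbit {y : ℝ → Fin n → ℝ} {T : EReal}
    (hy : N.IsMaximalTrajectory O s y T) :
    T = ⊤ ∧ Tendsto (fun t => Metric.infDist (y t) (hC.orbit v)) atTop (𝓝 0) := by
  obtain ⟨i, hi⟩ := hy.1.mem 0 le_rfl hy.1.pos
  obtain ⟨p, hp, rfl⟩ : ∃ p < k, i = Fin.ofNat k p := ⟨i.val, i.isLt, by simp⟩
  have hT : T = ⊤ := (hy.eq_endTime hC hi).trans (hC.endTime_eq_top h hi hp)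
  subst hT
  refine ⟨rfl, ?_⟩
  rw [Metric.tendsto_atTop]
  intro ε hε
  obtain ⟨R, hR⟩ := h.exists_abs_ratio_sub_lt (hC.state_onWall_last hp hi) hC.none_not_switching hε
  have hclose : ∀ r, k - p + R ≤ r →
      dist (hC.pos p (y 0) r) (hC.pos 0 (hC.sectionPoint v) (p + r)) < ε := by
    intro r hr
    obtain ⟨r', rfl⟩ := Nat.exists_eq_add_of_le (show k - p ≤ r by omega)
    refine hC.dist_pos_lt hv _ hε fun j => ?_
    have h1 := h.ratio_mul_add none 1 r' j
    change hC.system.cyc 0 (1 * k + r') v j / hC.system.cyc 0 (1 * k + r') v none = _ at h1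
    rw [show p + (k - p + r') = 1 * k + r' by omega, h1, hC.state_add hp]
    exact hR r' (by omega) j
  refine ⟨hC.time p (y 0) (k - p + R), fun t ht => ?_⟩
  have ht0 : 0 ≤ t := (hC.time_nonneg hi _).trans ht
  obtain ⟨r', hr'⟩ := hC.exists_lt_time h hi hp t
  obtain ⟨r, hr, -, -, hseg⟩ := hC.exists_segment hi ht hr'
  rw [← hy.1.eq_sol hC hi ht0 (EReal.coe_lt_top _)] at hseg
  rw [Real.dist_eq, sub_zero, abs_of_nonneg Metric.infDist_nonneg]
  exact infDist_lt_of_segment (hclose r hr) (hclose (r + 1) (by omega)) hseg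
    (hC.segment_subset_orbit h (p + r))

/-- The orbit crosses each orthant of the cycle along one segment only. A point of it in the closed
orthant is either in that piece or already at the exit, where the claim is trivial. -/
theorem exit_of_mem_orbit {p : ℕ} {q : Fin n → ℝ} (hq : q ∈ hC.orbit v)
    (hqp : ∀ j, 0 ≤ boolSign (O (Fin.ofNat k p) j) * (q j - N.θ j)) :
    hC.pos p q 1 = hC.pos 0 (hC.sectionPoint v) (p + 1) ∧
      segment ℝ q (hC.pos 0 (hC.sectionPoint v) (p + 1)) ⊆ hC.orbit v := by
  have hx := hC.sectionPoint_mem h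
  have hqm := hq
  obtain ⟨t, ht, rfl⟩ := hq
  obtain ⟨r', hr'⟩ := hC.exists_lt_time h hx (Nat.pos_of_ne_zero (NeZero.ne k)) t
  obtain ⟨r, hr1, hr2⟩ := hC.exists_time_mem ht hr'
  have hmem := hC.sol_mem hx r hr1 hr2
  have hsol := hC.sol_eq hx r hr1 hr2.le
  rw [zero_add] at hmem hsol
  set q := hC.sol 0 (hC.sectionPoint v) t
  rcases hC.eq_or_of_mem_piece hmem hqp with hpr | ⟨hpr, hw⟩
  · have hnext : hC.pos 0 (hC.sectionPoint v) (p + 1) = hC.pos 0 (hC.sectionPoint v) (r + 1) :=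
      hC.pos_sectionPoint_congr h hv (by rw [Fin.ofNat_succ', hpr, ← Fin.ofNat_succ'])
    rw [hnext]
    constructor
    · have hflow := hC.flow_pos hx r
      have hexp := hC.exp_time_sub hx r
      rw [zero_add] at hflow hexp
      rw [hC.pos_one_of_flow (by rw [hpr]; exact hmem)
        (t := hC.time 0 (hC.sectionPoint v) (r + 1) - t), hpr, hsol, flow_flow, ← hflow]
      · congr 1
        ring
      · rw [hpr, hsol, hC.exitFactor_flow, ← hexp, ← Real.exp_add]
        congr 1
        ring
    · exact ((convex_segment _ _).segment_subset (hC.sol_mem_segment hx hr1 hr2.le)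
        (right_mem_segment ℝ _ _)).trans (hC.segment_subset_orbit h r)
  · have ht0 : t - hC.time 0 (hC.sectionPoint v) r = 0 := by
      refine le_antisymm ?_ (sub_nonneg.2 hr1)
      by_contra! hpos
      have hpm := hC.pos_mem hx r
      rw [zero_add] at hpm
      have := hC.flow_pos_of_wall hpm hpos
      rw [← hsol, hw] at this
      simp at this
    rw [ht0, flow_zero] at hsol
    have hnext : hC.pos 0 (hC.sectionPoint v) (p + 1) = q := by
      rw [hsol]
      exact hC.pos_sectionPoint_congr h hv (by rw [Fin.ofNat_succ', hpr, sub_add_cancel])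
    rw [hnext, segment_same]
    exact ⟨hC.pos_one_of_wall (by rw [hpr]; exact hw), singleton_subset_iff.2 hqm⟩

/-- Starting points near the orbit need not be on a wall, so the first crossing is treated
separately, by compactness of the orbit. Closed orthants replace the pieces, which are not closed,
and `q` anchors the first segment to the orbit. -/
theorem exists_forall_exit_close {ε : Fin k → ℝ} (hε : ∀ i, 0 < ε i) : ∃ δ : ℝ, 0 < δ ∧
    ∀ p < k, ∀ x ∈ N.piece O s (Fin.ofNat k p), Metric.infDist x (hC.orbit v) < δ →
      dist (hC.pos p x 1) (hC.pos 0 (hC.sectionPoint v) (p + 1)) < ε (Fin.ofNat k p) ∧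
      ∃ q, dist x q < ε (Fin.ofNat k p) ∧
        segment ℝ q (hC.pos 0 (hC.sectionPoint v) (p + 1)) ⊆ hC.orbit v := by
  have hx := hC.sectionPoint_mem h
  have hev : ∀ᶠ δ in 𝓝[>] (0 : ℝ), ∀ p : Fin k, ∀ x ∈ N.piece O s (Fin.ofNat k p),
      Metric.infDist x (hC.orbit v) < δ →
      dist (hC.pos p x 1) (hC.pos 0 (hC.sectionPoint v) (p + 1)) < ε (Fin.ofNat k p) ∧
      ∃ q, dist x q < ε (Fin.ofNat k p) ∧
        segment ℝ q (hC.pos 0 (hC.sectionPoint v) (p + 1)) ⊆ hC.orbit v := by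
    rw [eventually_all]
    intro p
    set K : Set (Fin n → ℝ) := {x | ∀ j, 0 ≤ boolSign (O (Fin.ofNat k p) j) * (x j - N.θ j)}
      with hKdef
    have hK : IsClosed K := by
      rw [hKdef, ofPred_forall]
      exact isClosed_iInter fun j => isClosed_le continuous_const (by fun_prop)
    have hne : (hC.orbit v).Nonempty := ⟨_, hC.pos_mem_orbit h 0⟩
    have hne' : (hC.orbit v ∩ K).Nonempty := by
      refine ⟨_, hC.pos_mem_orbit h p, fun j => ?_⟩
      have := hC.pos_mem hx p
      rw [zero_add] at this
      exact hC.piece_nonneg this j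
    have hcomp := hC.isCompact_orbit h hv
    have h1 := hcomp.eventually_lt_of_infDist_lt hne hK
      (h := fun x => dist (hC.pos p x 1) (hC.pos 0 (hC.sectionPoint v) (p + 1)))
      ((continuous_id.dist continuous_const).comp_continuousOn (hC.continuousOn_pos_one p))
      (fun q hq hqK => by rw [(hC.exit_of_mem_orbit h hv hq hqK).1, dist_self])
      (hε (Fin.ofNat k p))
    have h2 := hcomp.eventually_lt_of_infDist_lt hne hK
      (h := fun x => Metric.infDist x (hC.orbit v ∩ K))
      (Metric.continuous_infDist_pt _).continuousOn
      (fun q hq hqK => Metric.infDist_zero_of_mem ⟨hq, hqK⟩) (hε (Fin.ofNat k p))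
    filter_upwards [h1, h2] with δ h1 h2 x hxp hxδ
    have hxK : x ∈ K := hC.piece_nonneg hxp
    refine ⟨h1 x hxK hxδ, ?_⟩
    obtain ⟨q, ⟨hq, hqK⟩, hqd⟩ := (Metric.infDist_lt_iff hne').1 (h2 x hxK hxδ)
    exact ⟨q, hqd, (hC.exit_of_mem_orbit h hv hq hqK).2⟩
  obtain ⟨δ, hδ, hδ0⟩ := (hev.and self_mem_nhdsWithin).exists
  exact ⟨δ, hδ0, fun p hp => hδ ⟨p, hp⟩⟩

theorem isAsymptoticallyStable_orbit : N.IsAsymptoticallyStable O s (hC.orbit v) := by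
  -- Attraction is global, so the radius `1` is arbitrary.
  refine ⟨fun ε hε => ?_, 1, one_pos, fun y T hy _ => hC.tendsto_infDist_orbit h hv hy⟩
  choose δ₀ hδ₀ hclose using fun p : ℕ =>
    h.exists_forall_abs_ratio_sub_lt hC.none_not_switching hε p
  -- The first exit must be `δ₀`-close to that of the orbit, so that all later switching points
  -- remain `ε`-close.
  obtain ⟨δ, hδ, hexit⟩ := hC.exists_forall_exit_close h hv
    (ε := fun i => min ε (δ₀ i.val)) fun i => lt_min hε (hδ₀ _)
  refine ⟨δ, hδ, fun y T hy hyδ => ?_⟩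
  have hT := (hC.tendsto_infDist_orbit h hv hy).1
  subst hT
  refine ⟨rfl, fun t ht => ?_⟩
  obtain ⟨i, hi⟩ := hy.1.mem 0 le_rfl hy.1.pos
  obtain ⟨p, hp, rfl⟩ : ∃ p < k, i = Fin.ofNat k p := ⟨i.val, i.isLt, by simp⟩
  obtain ⟨h1, q, hq, hseg⟩ := hexit p hp (y 0) hi hyδ
  have hpk : (Fin.ofNat k p).val = p := Nat.mod_eq_of_lt hp
  rw [hpk] at h1 hq
  have hlater : ∀ r, dist (hC.pos p (y 0) (r + 1))
      (hC.pos 0 (hC.sectionPoint v) (p + (r + 1))) < ε := by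
    intro r
    refine hC.dist_pos_lt hv _ hε fun j => ?_
    have h2 := hclose p _ (hC.state_onWall hi 0) (hC.abs_ratio_sub_lt_of_dist h hv (y 0) 1
      (hδ₀ p) (h1.trans_le (min_le_right _ _))
      (zero_lt_one.trans_le (hC.one_le_state_none hi 1)).ne') r j
    have h3 : hC.system.cyc (p + 1) r (hC.state p (y 0) (0 + 1)) = hC.state p (y 0) (r + 1) := by
      rw [add_comm r 1]
      exact (CyclicSystem.cyc_add _ _ _ _ _).symm
    rw [h3] at h2
    rwa [show p + (r + 1) = p + 1 + r by ring]
  obtain ⟨r', hr'⟩ := hC.exists_lt_time h hi hp t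
  obtain ⟨r, -, -, -, hsegt⟩ := hC.exists_segment hi (R := 0) (by rw [hC.time_zero]; exact ht) hr'
  rw [← hy.1.eq_sol hC hi ht (EReal.coe_lt_top _)] at hsegt
  cases r with
  | zero =>
    rw [pos_zero] at hsegt
    exact infDist_lt_of_segment (hq.trans_le (min_le_left _ _)) (hlater 0) hsegt hseg
  | succ r =>
    exact infDist_lt_of_segment (hlater r) (hlater (r + 1)) hsegt
      (hC.segment_subset_orbit h (p + (r + 1)))

/-- The distance to the orbit tends to `0` along returns to a fixed point, so it is `0` there. The
trajectory is then a time shift of the canonical one, and periodicity makes the images equal. -/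
theorem eq_orbit_of_isPeriodicOrbit {γ : Set (Fin n → ℝ)} (hγ : N.IsPeriodicOrbit O s γ) :
    γ = hC.orbit v := by
  obtain ⟨y, P, hy, hP, hper, rfl⟩ := hγ
  have hx := hC.sectionPoint_mem h
  have hk : 0 < k := Nat.pos_of_ne_zero (NeZero.ne k)
  have hlim := (hC.tendsto_infDist_orbit h hv hy.isMaximal_of_top).2
  have hmem : ∀ t, 0 ≤ t → y t ∈ hC.orbit v := by
    intro t ht
    rw [(hC.isCompact_orbit h hv).isClosed.mem_iff_infDist_zero ⟨_, hC.pos_mem_orbit h 0⟩]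
    have h1 : Tendsto (fun q : ℕ => t + q * P) atTop atTop :=
      tendsto_atTop_add_const_left _ _ (tendsto_natCast_atTop_atTop.atTop_mul_const hP)
    refine tendsto_nhds_unique (tendsto_const_nhds.congr fun q => ?_) (hlim.comp h1)
    simp only [Function.comp, periodic_nat hP hper q ht]
  obtain ⟨t₀, ht₀, hyt₀⟩ := hmem 0 le_rfl
  have ht₀' : 0 ≤ t₀ := ht₀
  have hshift := (hC.isTrajectory_sol_top h hx hk).shift ht₀'
  obtain ⟨i, hi⟩ := hy.mem 0 le_rfl hy.pos
  obtain ⟨p, rfl⟩ : ∃ p, i = Fin.ofNat k p := ⟨i.val, by simp⟩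
  have hysol : ∀ u, 0 ≤ u → y u = hC.sol 0 (hC.sectionPoint v) (u + t₀) := by
    intro u hu
    have h0 : hC.sol 0 (hC.sectionPoint v) (0 + t₀) = y 0 := by rw [zero_add, hyt₀]
    have h1 := hshift.eq_sol hC (p := p) (by simp only [h0]; exact hi) hu (EReal.coe_lt_top _)
    simp only [h0] at h1
    rw [h1, hy.eq_sol hC hi hu (EReal.coe_lt_top _)]
  apply Subset.antisymm
  · rintro _ ⟨t, ht, rfl⟩
    exact hmem t ht
  · rintro _ ⟨t, ht, rfl⟩
    have ht' : 0 ≤ t := ht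
    have hQ := hC.period_pos h
    obtain ⟨q, hq⟩ := exists_nat_gt (t₀ / hC.time 0 (hC.sectionPoint v) k)
    rw [div_lt_iff₀ hQ] at hq
    have hnn : 0 ≤ t + q * hC.time 0 (hC.sectionPoint v) k - t₀ := by linarith
    refine ⟨_, hnn, ?_⟩
    rw [hysol _ hnn, sub_add_cancel,
      periodic_nat hQ (fun t ht => hC.sol_add_period h hv ht) q ht']

theorem hasUniqueStablePeriodicOrbit : N.HasUniqueStablePeriodicOrbit O s :=
  ⟨hC.orbit v, hC.isPeriodicOrbit_orbit h hv,
    fun _ hγ' => hC.eq_orbit_of_isPeriodicOrbit h hv hγ', hC.isAsymptoticallyStable_orbit h hv⟩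

end

/-! ### Comparison with the matrices of the return map -/

/-- The first `r` steps in absolute coordinates, in terms of the step matrices. -/
theorem cyc_eq_prodMatrix (x : Fin n → ℝ) (c : ℝ) (X : Option (Fin n) → ℝ) (hXn : X none = c)
    (hXs : ∀ j, X (some j) = boolSign (O (Fin.ofNat k 0) j) * x j) (r : ℕ) :
    hC.system.cyc 0 r X none = c + (∑ j ∈ Finset.range r,
        Matrix.vecMul (N.stepCovector O s (Fin.ofNat k j)) (N.prodMatrix O s j)) ⬝ᵥ x ∧
      ∀ j, hC.system.cyc 0 r X (some j) =
        boolSign (O (Fin.ofNat k r) j) * (N.prodMatrix O s r).mulVec x j := by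
  induction r with
  | zero => simpa [prodMatrix, hXn] using hXs
  | succ r ih =>
    obtain ⟨ih1, ih2⟩ := ih
    set i := Fin.ofNat k r with hi
    set z := (N.prodMatrix O s r).mulVec x with hz
    have hg := (hC.focal_side i (s i)).ne'
    -- The speed is signed by the region being entered, the coordinate by the region being left;
    -- this flip gives the minus signs in `B` and `ψ`.
    have hG : boolSign (O (i + 1) (s i)) * (N.focal (O i) (s i) - N.θ (s i)) =
        -(boolSign (O i (s i)) * (N.focal (O i) (s i) - N.θ (s i))) := by
      rw [hC.apply_self, boolSign_not, neg_mul]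
    have hb : boolSign (O i (s i)) ≠ 0 := by
      cases O i (s i) <;> simp [boolSign]
    have hf : N.focal (O i) (s i) - N.θ (s i) ≠ 0 := sub_ne_zero.2 (N.focal_ne _ _)
    rw [CyclicSystem.cyc_succ, zero_add]
    constructor
    · rw [hC.system.step_apply_of_ne r _ (hC.none_ne_m r), ih1]
      have h1 : hC.system.g r none / hC.system.g r (hC.system.m r) *
          hC.system.cyc 0 r X (hC.system.m r) = 1 /
          (boolSign (O (i + 1) (s i)) * (N.focal (O i) (s i) - N.θ (s i))) *
          hC.system.cyc 0 r X (some (s i)) := rfl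
      rw [h1, ih2, Finset.sum_range_succ, add_dotProduct, ← Matrix.dotProduct_mulVec, ← hz,
        stepCovector, ← hi, single_dotProduct, hG]
      field_simp
      ring
    · intro j
      have hB : (N.prodMatrix O s (r + 1)).mulVec x j =
          z j - (N.focal (O i) j - N.θ j) * ((N.focal (O i) (s i) - N.θ (s i))⁻¹ * z (s i)) := by
        rw [prodMatrix, ← Matrix.mulVec_mulVec, ← hz, stepMatrix, ← hi, Matrix.sub_mulVec,
          Matrix.one_mulVec, Matrix.vecMulVec_mulVec, single_dotProduct]
        simp
      rw [hB, Fin.ofNat_succ', ← hi]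
      by_cases hj : j = s i
      · subst hj
        rw [hi, hC.step_self, ← hi]
        field_simp
        ring
      · rw [hC.step_some r _ hj, ← hi, ih2, ih2, hG, hC.apply_of_ne hj]
        field_simp
        ring

/-- The loop in absolute coordinates is given by the data of the Poincaré return map. -/
theorem loop_eq (x : Fin n → ℝ) (c : ℝ) (X : Option (Fin n) → ℝ) (hXn : X none = c)
    (hXs : ∀ j, X (some j) = boolSign (O (Fin.ofNat k 0) j) * x j) :
    hC.system.loop X none = c + N.returnCovector O s ⬝ᵥ x ∧
      ∀ j, hC.system.loop X (some j) =
        boolSign (O (Fin.ofNat k 0) j) * (N.returnMatrix O s).mulVec x j := by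
  have := hC.cyc_eq_prodMatrix x c X hXn hXs k
  have h2 : Fin.ofNat k k = Fin.ofNat k 0 := by
    have := Fin.ofNat_add_self k 0
    rwa [zero_add] at this
  rw [h2] at this
  exact this

end BinaryGlassNetwork.IsCyclicAttractor

/-! ### The dichotomy and the formula for the orbit -/

theorem theorem5p3 {n k : ℕ} [NeZero k] (N : BinaryGlassNetwork n)
    (O : Fin k → Fin n → Bool) (s : Fin k → Fin n) (hC : N.IsCyclicAttractor O s) :
    -- exactly one of the two cases holds
    ((N.HasUniqueStablePeriodicOrbit O s ∨ N.AllConvergeToSpine O s) ∧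
      ¬ (N.HasUniqueStablePeriodicOrbit O s ∧ N.AllConvergeToSpine O s)) ∧
    -- the case is determined by the eigenvalues of the matrix of the return map
    (N.HasUniqueStablePeriodicOrbit O s ↔
      ∃ μ : ℝ, 1 < μ ∧ Module.End.HasEigenvalue (Matrix.toLin' (N.returnMatrix O s)) μ) ∧
    -- the periodic orbit crosses the section at an explicitly normalised eigenvector for the
    -- largest eigenvalue, whose eigenspace is a line
    (∀ γ : Set (Fin n → ℝ), N.IsPeriodicOrbit O s γ →
      ∃ (l : ℝ) (v : Fin n → ℝ), 1 < l ∧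
        IsGreatest {μ : ℝ | Module.End.HasEigenvalue (Matrix.toLin' (N.returnMatrix O s)) μ} l ∧
        Module.End.eigenspace (Matrix.toLin' (N.returnMatrix O s)) l = Submodule.span ℝ {v} ∧
        N.returnCovector O s ⬝ᵥ v = l - 1 ∧
        N.θ + v ∈ γ ∩ N.wall (O 0) (s (0 - 1))) := by
  obtain ⟨l, u, hu⟩ := hC.system.exists_isPerron
  -- An eigenvector of `A` extends to one of the loop: the new coordinate `c` must satisfy `c + ⟨φ,
  -- x⟩ = μ c`, which is solvable for `μ ≠ 1`.
  have hlift : ∀ (μ : ℝ) (x : Fin n → ℝ), 1 < μ → (N.returnMatrix O s).mulVec x = μ • x →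
      ∃ X : Option (Fin n) → ℝ, hC.system.loop X = μ • X ∧
        ∀ j, X (some j) = boolSign (O (Fin.ofNat k 0) j) * x j := by
    intro μ x hμ hx
    obtain ⟨X, hXn, hXs⟩ : ∃ X : Option (Fin n) → ℝ,
        X none = N.returnCovector O s ⬝ᵥ x / (μ - 1) ∧
        ∀ j, X (some j) = boolSign (O (Fin.ofNat k 0) j) * x j :=
      ⟨fun j => j.elim (N.returnCovector O s ⬝ᵥ x / (μ - 1)) fun j =>
        boolSign (O (Fin.ofNat k 0) j) * x j, rfl, fun j => rfl⟩
    obtain ⟨h1, h2⟩ := hC.loop_eq x _ X hXn hXs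
    refine ⟨X, ?_, hXs⟩
    ext j
    cases j with
    | none =>
      have : μ - 1 ≠ 0 := by linarith
      rw [h1, Pi.smul_apply, hXn, smul_eq_mul]
      field_simp
      ring
    | some j =>
      rw [h2, hx, Pi.smul_apply, Pi.smul_apply, hXs, smul_eq_mul, smul_eq_mul]
      ring
  have hle : ∀ μ : ℝ, 1 < μ → Module.End.HasEigenvalue (Matrix.toLin' (N.returnMatrix O s)) μ →
      μ ≤ l := by
    intro μ hμ hev
    obtain ⟨x, hx⟩ := hev.exists_hasEigenvector
    have hx' : (N.returnMatrix O s).mulVec x = μ • x := by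
      simpa using hx.apply_eq_smul
    obtain ⟨X, hX, hXs⟩ := hlift μ x hμ hx'
    refine hu.eigenvalue_le hμ (fun h0 => hx.2 ?_) hX
    ext j
    have := hXs j
    rw [h0] at this
    rw [← boolSign_mul_mul (O (Fin.ofNat k 0) j) (x j), ← this]
    simp
  have hexcl : ¬ (N.HasUniqueStablePeriodicOrbit O s ∧ N.AllConvergeToSpine O s) := by
    rintro ⟨⟨γ, hγ, -⟩, hall⟩
    exact BinaryGlassNetwork.not_allConvergeToSpine_of_periodic hC hγ hall
  rcases le_or_gt l 1 with hl | hl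
  · have hall := hC.allConvergeToSpine_of_isPerron hu hl
    refine ⟨⟨Or.inr hall, hexcl⟩, ⟨fun h => absurd ⟨h, hall⟩ hexcl, ?_⟩, fun γ hγ => ?_⟩
    · rintro ⟨μ, hμ, hev⟩
      linarith [hle μ hμ hev]
    · exact absurd hall (BinaryGlassNetwork.not_allConvergeToSpine_of_periodic hC hγ)
  · obtain ⟨V, hV, hVn⟩ := hu.exists_positiveEigenvector hl hC.none_not_switching
    have hper := hC.hasUniqueStablePeriodicOrbit hV hVn
    obtain ⟨v, hv⟩ : ∃ v : Fin n → ℝ,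
        ∀ j, V (some j) = boolSign (O (Fin.ofNat k 0) j) * v j :=
      ⟨fun j => boolSign (O (Fin.ofNat k 0) j) * V (some j), fun j => (boolSign_mul_mul _ _).symm⟩
    obtain ⟨h1, h2⟩ := hC.loop_eq v 1 V hVn hv
    rw [hV.loop_eq] at h1 h2
    have hφ : N.returnCovector O s ⬝ᵥ v = l - 1 := by
      rw [Pi.smul_apply, hVn, smul_eq_mul, mul_one] at h1
      linarith
    have hA : (N.returnMatrix O s).mulVec v = l • v := by
      ext j
      have h3 := h2 j
      rw [Pi.smul_apply, hv, smul_eq_mul, mul_left_comm] at h3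
      have h4 := congrArg (fun t => boolSign (O (Fin.ofNat k 0) j) * t) h3
      simp only [boolSign_mul_mul] at h4
      exact h4.symm
    have hv0 : v ≠ 0 := by
      rintro rfl
      rw [dotProduct_zero] at hφ
      linarith
    have hev : Module.End.HasEigenvalue (Matrix.toLin' (N.returnMatrix O s)) l :=
      Module.End.hasEigenvalue_of_hasEigenvector
        ⟨Module.End.mem_eigenspace_iff.2 (by simpa using hA), hv0⟩
    refine ⟨⟨Or.inl hper, hexcl⟩, ⟨fun _ => ⟨l, hl, hev⟩, fun _ => hper⟩, fun γ hγ => ?_⟩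
    -- With `V none = 1`, the quotients defining the section point are the coordinates of `V`, which
    -- are those of `v` up to sign.
    have hpt : N.θ + v = hC.sectionPoint V := by
      ext j
      rw [BinaryGlassNetwork.IsCyclicAttractor.sectionPoint, BinaryGlassNetwork.point, hVn, div_one, hv,
        boolSign_mul_mul]
      rfl
    have hmem := hC.sectionPoint_mem hV
    refine ⟨l, v, hl, ⟨hev, fun μ hμ => ?_⟩, ?_, hφ, ?_, ?_⟩
    · rcases le_or_gt μ 1 with h | h
      · linarith
      · exact hle μ h hμ
    · ext x
      rw [Module.End.mem_eigenspace_iff, Matrix.toLin'_apply, Submodule.mem_span_singleton]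
      constructor
      · intro hx
        obtain ⟨X, hX, hXs⟩ := hlift l x hl hx
        obtain ⟨c, rfl⟩ := hV.eq_smul hX
        refine ⟨c, ?_⟩
        ext j
        have h3 := hXs j
        rw [Pi.smul_apply, hv, smul_eq_mul, mul_left_comm] at h3
        have h4 := congrArg (fun t => boolSign (O (Fin.ofNat k 0) j) * t) h3
        simp only [boolSign_mul_mul] at h4
        exact h4
      · rintro ⟨c, rfl⟩
        rw [Matrix.mulVec_smul, hA, smul_comm]
    · rw [hC.eq_orbit_of_isPeriodicOrbit hV hVn hγ, hpt]
      have := hC.pos_mem_orbit hV 0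
      rwa [hC.pos_zero] at this
    · have hz : Fin.ofNat k 0 = 0 := rfl
      rw [hz] at hmem hv
      rw [← hpt] at hmem
      have hlast : v (s (0 - 1)) = 0 := by
        have h3 : V (hC.system.m (hC.system.k - 1)) = 0 := hV.onWall.1
        have h4 : hC.system.m (hC.system.k - 1) = some (s (0 - 1)) := by
          change some (s (Fin.ofNat k (hC.system.k - 1))) = _
          congr 2
          rw [eq_sub_iff_add_eq, ← Fin.ofNat_succ', Nat.sub_add_cancel hC.system.k_pos]
          have := Fin.ofNat_add_self k 0
          rwa [zero_add] at this
        rw [h4, hv] at h3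
        rw [← boolSign_mul_mul (O 0 (s (0 - 1))) (v _), h3, mul_zero]
      refine ⟨by rw [Pi.add_apply, hlast, add_zero], fun j hj => ?_⟩
      rw [BinaryGlassNetwork.onSide_iff]
      exact (BinaryGlassNetwork.mem_piece_iff.1 hmem).1 j hj
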